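/- All graphs are finite and undirected, and may have loops and multi-edges. A graph is a \emph{block graph} if each of its maximal $2$-connected subgraphs is a clique (its vertices are pairwise adjacent; loops and the multiplicities of edges play no role). A set $S \subseteq V(G)$ is a \emph{block vertex deletion set} of $G$ if $G \setminus S$, the graph obtained from $G$ by deleting the vertices of $S$, is a block graph; let $\mathsf{OPT}(G)$ be the minimum size of a block vertex deletion set of $G$. \textbf{Theorem.} \textsc{Block Graph Vertex Deletion} (BGVD) admits a polynomial-time factor four approximation algorithm: there are a deterministic algorithm and a polynomial $P$ such that, for every graph $G$ on $n$ vertices, given by its adjacency matrix (with multiplicities), the algorithm halts after at most $P(n)$ steps and outputs a block vertex deletion set $S$ of $G$ with $|S| \le 4\cdot \mathsf{OPT}(G)$. Here an algorithm is a program of a random access machine whose memory cells hold natural numbers, with addition, truncated subtraction, reading and writing of memory cells (with indirect addressing), and tests for zero as its unit-cost operations. -/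

import Mathlib

namespace BGVD

section Graphs

/-- `B` is the vertex set of a 2-connected (induced) subgraph of `G`: it has more than two vertices,
`G[B]` is connected, and it stays connected after the removal of any one vertex. -/
def IsTwoConnected {V : Type*} (G : SimpleGraph V) (B : Set V) : Prop :=
  2 < B.encard ∧ (G.induce B).Connected ∧ ∀ v ∈ B, (G.induce (B \ {v})).Connected

/-- A block graph: every maximal 2-connected subgraph is a clique. A maximal 2-connected subgraph
is always induced, so that it is enough to speak of vertex sets. -/
def IsBlockGraph {V : Type*} (G : SimpleGraph V) : Prop :=
  ∀ B : Set V, Maximal (IsTwoConnected G) B → G.IsClique B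

/-- A finite undirected graph on the vertices `0, …, n - 1`, possibly with loops and multi-edges:
`mult u v` is the number of edges that join `u` and `v`. Simple graphs are those with
`mult u v ≤ 1` and `mult u u = 0`. -/
structure Graph (n : ℕ) where
  mult : Fin n → Fin n → ℕ
  symm : ∀ u v, mult u v = mult v u

/-- The adjacency relation between distinct vertices. Neither 2-connectivity nor being a clique
depends on loops or on the multiplicities of edges. -/
def Graph.adjacency {n : ℕ} (G : Graph n) : SimpleGraph (Fin n) where
  Adj u v := u ≠ v ∧ 0 < G.mult u v
  symm := ⟨fun u v h => ⟨h.1.symm, by rw [G.symm v u]; exact h.2⟩⟩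
  loopless := ⟨fun _ h => h.1 rfl⟩

/-- `S` is a block vertex deletion set of `G`: the graph `G ∖ S` is a block graph. -/
def IsDeletionSet {n : ℕ} (G : Graph n) (S : Finset (Fin n)) : Prop :=
  IsBlockGraph (G.adjacency.induce ((S : Set (Fin n))ᶜ))

/-- The minimum size of a block vertex deletion set (see `exists_card_eq_opt`). -/
noncomputable def opt {n : ℕ} (G : Graph n) : ℕ :=
  sInf {k : ℕ | ∃ S : Finset (Fin n), IsDeletionSet G S ∧ S.card = k}

theorem isDeletionSet_univ {n : ℕ} (G : Graph n) : IsDeletionSet G Finset.univ := by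
  intro B _ x _
  exact absurd (Finset.mem_coe.2 (Finset.mem_univ x.1)) x.2

theorem exists_card_eq_opt {n : ℕ} (G : Graph n) :
    ∃ S : Finset (Fin n), IsDeletionSet G S ∧ S.card = opt G :=
  Nat.sInf_mem (s := {k : ℕ | ∃ S : Finset (Fin n), IsDeletionSet G S ∧ S.card = k})
    ⟨_, Finset.univ, isDeletionSet_univ G, rfl⟩

theorem opt_le_card {n : ℕ} (G : Graph n) {S : Finset (Fin n)} (hS : IsDeletionSet G S) :
    opt G ≤ S.card :=
  Nat.sInf_le ⟨S, hS, rfl⟩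

end Graphs

section Machine

/-! A random access machine with structured programs. The memory consists of registers and of
two-dimensional arrays, whose cells hold natural numbers. The only arithmetic operations are
addition and truncated subtraction, each at unit cost; there is no multiplication, so that the
bit lengths of the numbers grow by at most a constant in each step, and polynomial time on this
machine is polynomial time on a Turing machine. -/

/-- A memory state: `reg x` is the content of register `x`, and `arr a i j` is the content of
cell `(i, j)` of array `a`. -/
structure State where
  reg : ℕ → ℕ
  arr : ℕ → ℕ → ℕ → ℕ

/-- Expressions; `read a i j` is indirect addressing in array `a`. -/
inductive Expr : Type
  | const (c : ℕ)
  | var (x : ℕ)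
  | read (a : ℕ) (i j : Expr)
  | add (e f : Expr)
  | sub (e f : Expr)

def Expr.eval (s : State) : Expr → ℕ
  | .const c => c
  | .var x => s.reg x
  | .read a i j => s.arr a (i.eval s) (j.eval s)
  | .add e f => e.eval s + f.eval s
  | .sub e f => e.eval s - f.eval s

/-- The number of steps for the evaluation of an expression: one for each operation in it. -/
def Expr.cost : Expr → ℕ
  | .const _ => 1
  | .var _ => 1
  | .read _ i j => i.cost + j.cost + 1
  | .add e f => e.cost + f.cost + 1
  | .sub e f => e.cost + f.cost + 1

/-- Programs: finite syntax trees. A test succeeds when its expression is nonzero. -/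
inductive Prog : Type
  | skip
  | assign (x : ℕ) (e : Expr)
  | write (a : ℕ) (i j e : Expr)
  | seq (p q : Prog)
  | ite (e : Expr) (p q : Prog)
  | loop (e : Expr) (p : Prog)

def State.setReg (s : State) (x v : ℕ) : State :=
  { s with reg := Function.update s.reg x v }

def State.setArr (s : State) (a i j v : ℕ) : State :=
  { s with arr := fun a' i' j' => if a' = a ∧ i' = i ∧ j' = j then v else s.arr a' i' j' }

/-- `Exec p s t s'`: started in state `s`, the program `p` halts after exactly `t` steps, in
state `s'`. -/
inductive Exec : Prog → State → ℕ → State → Prop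
  | skip (s : State) : Exec .skip s 1 s
  | assign (s : State) (x : ℕ) (e : Expr) :
      Exec (.assign x e) s (e.cost + 1) (s.setReg x (e.eval s))
  | write (s : State) (a : ℕ) (i j e : Expr) :
      Exec (.write a i j e) s (i.cost + j.cost + e.cost + 1)
        (s.setArr a (i.eval s) (j.eval s) (e.eval s))
  | seq {p q : Prog} {s s₁ s₂ : State} {t₁ t₂ : ℕ} (hp : Exec p s t₁ s₁)
      (hq : Exec q s₁ t₂ s₂) : Exec (.seq p q) s (t₁ + t₂) s₂
  | iteTrue {e : Expr} {p q : Prog} {s s' : State} {t : ℕ} (he : e.eval s ≠ 0)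
      (hp : Exec p s t s') : Exec (.ite e p q) s (e.cost + 1 + t) s'
  | iteFalse {e : Expr} {p q : Prog} {s s' : State} {t : ℕ} (he : e.eval s = 0)
      (hq : Exec q s t s') : Exec (.ite e p q) s (e.cost + 1 + t) s'
  | loopDone {e : Expr} {p : Prog} {s : State} (he : e.eval s = 0) :
      Exec (.loop e p) s (e.cost + 1) s
  | loopStep {e : Expr} {p : Prog} {s s₁ s₂ : State} {t₁ t₂ : ℕ} (he : e.eval s ≠ 0)
      (hp : Exec p s t₁ s₁) (hl : Exec (.loop e p) s₁ t₂ s₂) :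
      Exec (.loop e p) s (e.cost + 1 + t₁ + t₂) s₂

/-- The machine is deterministic. -/
theorem Exec.deterministic {p : Prog} {s s₁ s₂ : State} {t₁ t₂ : ℕ} (h₁ : Exec p s t₁ s₁)
    (h₂ : Exec p s t₂ s₂) : t₁ = t₂ ∧ s₁ = s₂ := by
  induction h₁ generalizing t₂ s₂ with
  | skip | assign | write => cases h₂; exact ⟨rfl, rfl⟩
  | seq _ _ ihp ihq =>
    cases h₂ with
    | seq hp hq =>
      obtain ⟨rfl, rfl⟩ := ihp hp
      obtain ⟨rfl, rfl⟩ := ihq hq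
      exact ⟨rfl, rfl⟩
  | iteTrue he _ ih =>
    cases h₂ with
    | iteTrue _ hp => obtain ⟨rfl, rfl⟩ := ih hp; exact ⟨rfl, rfl⟩
    | iteFalse he' _ => exact absurd he' he
  | iteFalse he _ ih =>
    cases h₂ with
    | iteTrue he' _ => exact absurd he he'
    | iteFalse _ hq => obtain ⟨rfl, rfl⟩ := ih hq; exact ⟨rfl, rfl⟩
  | loopDone he =>
    cases h₂ with
    | loopDone _ => exact ⟨rfl, rfl⟩
    | loopStep he' _ _ => exact absurd he he'
  | loopStep he _ _ ihp ihl =>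
    cases h₂ with
    | loopDone he' => exact absurd he' he
    | loopStep _ hp hl =>
      obtain ⟨rfl, rfl⟩ := ihp hp
      obtain ⟨rfl, rfl⟩ := ihl hl
      exact ⟨rfl, rfl⟩

/-- The initial state on input `G`: register `0` holds the number of vertices, array `0` holds the
adjacency matrix (with multiplicities), and everything else is `0`. -/
def input {n : ℕ} (G : Graph n) : State where
  reg x := if x = 0 then n else 0
  arr a i j := if h : a = 0 ∧ i < n ∧ j < n then G.mult ⟨i, h.2.1⟩ ⟨j, h.2.2⟩ else 0

/-- The vertex set that a final state outputs: its indicator vector is row `0` of array `1`. -/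
def output (n : ℕ) (s : State) : Finset (Fin n) :=
  Finset.univ.filter fun v : Fin n => s.arr 1 0 v ≠ 0

end Machine

/-- `p` is a polynomial-time factor-`α` approximation algorithm for Block Graph Vertex Deletion:
on every graph `G` with `n` vertices it halts within a number of steps polynomial in `n`, and
outputs a block vertex deletion set of size at most `α` times the minimum. -/
def IsApproxAlgorithm (α : ℕ) (p : Prog) : Prop :=
  ∃ P : Polynomial ℕ, ∀ (n : ℕ) (G : Graph n), ∃ (t : ℕ) (s : State),
    Exec p (input G) t s ∧ t ≤ P.eval n ∧
      IsDeletionSet G (output n s) ∧ (output n s).card ≤ α * opt G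

end BGVD

/-! A graph is a block graph exactly when every nonempty vertex set has a simplicial vertex
(`Dismantlable`, i.e. chordality) and there are no induced four-cycles or diamonds (`Good`); see
`isDeletionSet_iff`.

The algorithm deletes induced four-cycles and diamonds greedily, all four vertices at a time. Every
solution contains one of the four. Let `A` be what remains. There two maximal cliques share at most
one vertex, and a subset of `A` induces a block graph iff its incidence graph with the maximal
cliques of `A` is a forest (`Good.elim_iff`). What is left is a feedback vertex set problem in which
only the vertices of the graph may be deleted.

It is solved by the local ratio method with the weights `deg - 1`. The heart is `sum_deg_le`: if no
vertex is simplicial, a minimal feedback set `F` weighs at most four times any other one `F'`. Write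
w(F) for the weight and c(F) for the number of components of the forest left by `F`. By Euler's
formula w(F) - c(F) is the same for all feedback sets. Minimality gives each vertex of `F` a
component to which it sends two edges, and a charging argument yields 4c(F) ≤ 3w(F) + q, where q
counts isolated cycles. These lie in different components of the forest left by `F'`, so q ≤ c(F'),
and w(F) ≤ 4w(F') follows. `isSolution_solve` passes to arbitrary weights: subtract the multiple of
`deg - 1` that makes one vertex free, recurse, and restore that vertex to the solution only if it is
needed.

The two phases charge disjoint parts of an optimal solution, each with factor four. The algorithm is
written with loops bounded by `n`; `Stmt.runs_comp` bounds the time of the compiled program by a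
polynomial. -/

namespace BGVD

/-! ### Bounded loop programs and their compilation in polynomial time. -/

section BoundedLanguage

/-! A language of bounded loop programs that is compiled to the machine. All loops run over the
indices below the content `n` of register `0`, so that running times are polynomial in `n`. -/

/-- The contents of the user arrays. -/
abbrev Mem := ℕ → ℕ → ℕ → ℕ

/-- Terms; `sum x t` is the sum of `t` over all values below `n` of the variable `x`. -/
inductive Tm : Type
  | const (c : ℕ)
  | var (x : ℕ)
  | read (a : ℕ) (i j : Tm)
  | add (t u : Tm)
  | sub (t u : Tm)
  | cond (c t u : Tm)
  | sum (x : ℕ) (t : Tm)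

def Tm.eval (n : ℕ) (σ : Mem) : Tm → (ℕ → ℕ) → ℕ
  | .const c, _ => c
  | .var x, ρ => ρ x
  | .read a i j, ρ => σ a (i.eval n σ ρ) (j.eval n σ ρ)
  | .add t u, ρ => t.eval n σ ρ + u.eval n σ ρ
  | .sub t u, ρ => t.eval n σ ρ - u.eval n σ ρ
  | .cond c t u, ρ => if c.eval n σ ρ ≠ 0 then t.eval n σ ρ else u.eval n σ ρ
  | .sum x t, ρ => ∑ i ∈ Finset.range n, t.eval n σ (Function.update ρ x i)

/-- Statements: simultaneous assignment to all cells of an array with indices (variables `0` and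
`1`) below `n`, composition, and bounded loops. -/
inductive Stmt : Type
  | set (a : ℕ) (t : Tm)
  | seq (p q : Stmt)
  | loop (x : ℕ) (p : Stmt)

def setMem (n : ℕ) (σ : Mem) (a : ℕ) (f : ℕ → ℕ → ℕ) : Mem := fun b i j =>
  if b = a ∧ i < n ∧ j < n then f i j else σ b i j

/-- The environment in which the cell `(i, j)` is computed. -/
def cellEnv (ρ : ℕ → ℕ) (i j : ℕ) : ℕ → ℕ := Function.update (Function.update ρ 0 i) 1 j

def iter {α : Type*} (f : ℕ → α → α) : ℕ → α → α
  | 0, σ => σ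
  | m + 1, σ => f m (iter f m σ)

def Stmt.run (n : ℕ) : Stmt → (ℕ → ℕ) → Mem → Mem
  | .set a t, ρ, σ => setMem n σ a fun i j => t.eval n σ (cellEnv ρ i j)
  | .seq p q, ρ, σ => q.run n ρ (p.run n ρ σ)
  | .loop x p, ρ, σ => iter (fun i τ => p.run n (Function.update ρ x i) τ) n σ

/-- The register of a user variable. -/
def usr (x : ℕ) : ℕ := 2 * x + 1

/-- The registers for intermediate results. -/
def tmp (k : ℕ) : ℕ := 2 * k + 2

/-- The machine array that stores a user array; array `2` is used for intermediate results. -/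
def loc (a : ℕ) : ℕ := if a = 0 then 0 else 2 * a - 1

theorem usr_inj {x y : ℕ} : usr x = usr y ↔ x = y := by unfold usr; omega
theorem tmp_inj {x y : ℕ} : tmp x = tmp y ↔ x = y := by unfold tmp; omega
theorem usr_ne_tmp (x y : ℕ) : usr x ≠ tmp y := by unfold usr tmp; omega
theorem tmp_ne_usr (x y : ℕ) : tmp x ≠ usr y := by unfold usr tmp; omega
theorem zero_ne_usr (x : ℕ) : 0 ≠ usr x := by unfold usr; omega
theorem zero_ne_tmp (x : ℕ) : 0 ≠ tmp x := by unfold tmp; omega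
theorem loc_inj {x y : ℕ} : loc x = loc y ↔ x = y := by unfold loc; split_ifs <;> omega
theorem loc_ne_two (x : ℕ) : loc x ≠ 2 := by unfold loc; split_ifs <;> omega

/-- Saving the old value of the variable in `tmp k` and restoring it gives the loop variable a local
scope, as in the semantics by `Function.update`. -/
def forProg (x k : ℕ) (body : Prog) : Prog :=
  .seq (.assign (tmp k) (.var (usr x))) <|
  .seq (.assign (usr x) (.const 0)) <|
  .seq (.loop (.sub (.var 0) (.var (usr x)))
    (.seq body (.assign (usr x) (.add (.var (usr x)) (.const 1)))))
  (.assign (usr x) (.var (tmp k)))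

/-- Evaluate a term and store the result in `tmp k`. -/
def Tm.comp : Tm → ℕ → Prog
  | .const c, k => .assign (tmp k) (.const c)
  | .var x, k => .assign (tmp k) (.var (usr x))
  | .read a i j, k => .seq (i.comp k) <| .seq (j.comp (k + 1)) <|
      .assign (tmp k) (.read (loc a) (.var (tmp k)) (.var (tmp (k + 1))))
  | .add t u, k => .seq (t.comp k) <| .seq (u.comp (k + 1)) <|
      .assign (tmp k) (.add (.var (tmp k)) (.var (tmp (k + 1))))
  | .sub t u, k => .seq (t.comp k) <| .seq (u.comp (k + 1)) <|
      .assign (tmp k) (.sub (.var (tmp k)) (.var (tmp (k + 1))))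
  | .cond c t u, k => .seq (c.comp k) <| .ite (.var (tmp k)) (t.comp k) (u.comp k)
  | .sum x t, k => .seq (.assign (tmp k) (.const 0)) <|
      forProg x (k + 1) <| .seq (t.comp (k + 2)) <|
        .assign (tmp k) (.add (.var (tmp k)) (.var (tmp (k + 2))))

/-- The term of an assignment may read the array that is assigned. All values are therefore first
computed into the buffer, array `2`, and then copied. -/
def Stmt.comp : Stmt → ℕ → Prog
  | .set a t, k => .seq
      (forProg 0 k <| forProg 1 (k + 1) <| .seq (t.comp (k + 2)) <|
        .write 2 (.var (usr 0)) (.var (usr 1)) (.var (tmp (k + 2))))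
      (forProg 0 k <| forProg 1 (k + 1) <|
        .write (loc a) (.var (usr 0)) (.var (usr 1)) (.read 2 (.var (usr 0)) (.var (usr 1))))
  | .seq p q, k => .seq (p.comp k) (q.comp k)
  | .loop x p, k => forProg x k (p.comp (k + 1))

/-- `p` halts within `T` steps in a state with the property `Q`. -/
def Runs (p : Prog) (s : State) (T : ℕ) (Q : State → Prop) : Prop :=
  ∃ t s', Exec p s t s' ∧ t ≤ T ∧ Q s'

theorem Runs.mono {p : Prog} {s : State} {T T' : ℕ} {Q Q' : State → Prop} (h : Runs p s T Q)
    (hT : T ≤ T') (hQ : ∀ s', Q s' → Q' s') : Runs p s T' Q' := by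
  obtain ⟨t, s', h1, h2, h3⟩ := h
  exact ⟨t, s', h1, h2.trans hT, hQ _ h3⟩

theorem Runs.seq {p q : Prog} {s : State} {T T' : ℕ} {Q R : State → Prop} (h : Runs p s T Q)
    (h' : ∀ s', Q s' → Runs q s' T' R) : Runs (.seq p q) s (T + T') R := by
  obtain ⟨t, s', h1, h2, h3⟩ := h
  obtain ⟨t', s'', h1', h2', h3'⟩ := h' s' h3
  exact ⟨_, _, .seq h1 h1', Nat.add_le_add h2 h2', h3'⟩

theorem Runs.assign {s : State} {x : ℕ} {e : Expr} {T : ℕ} {Q : State → Prop}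
    (hT : e.cost + 1 ≤ T) (h : Q (s.setReg x (e.eval s))) : Runs (.assign x e) s T Q :=
  ⟨_, _, .assign s x e, hT, h⟩

theorem Runs.write {s : State} {a : ℕ} {i j e : Expr} {T : ℕ} {Q : State → Prop}
    (hT : i.cost + j.cost + e.cost + 1 ≤ T)
    (h : Q (s.setArr a (i.eval s) (j.eval s) (e.eval s))) : Runs (.write a i j e) s T Q :=
  ⟨_, _, .write s a i j e, hT, h⟩

/-- Register `0` holds `n`, and the user variables have the values `ρ`. -/
def Env (n : ℕ) (ρ : ℕ → ℕ) (s : State) : Prop :=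
  s.reg 0 = n ∧ ∀ x, s.reg (usr x) = ρ x

theorem Env.setTmp {n : ℕ} {ρ : ℕ → ℕ} {s : State} (h : Env n ρ s) (k v : ℕ) :
    Env n ρ (s.setReg (tmp k) v) := by
  refine ⟨?_, fun x => ?_⟩
  · simpa [State.setReg, Function.update, zero_ne_tmp] using h.1
  · simpa [State.setReg, Function.update, usr_ne_tmp] using h.2 x

theorem Env.setUsr {n : ℕ} {ρ : ℕ → ℕ} {s : State} (h : Env n ρ s) (x v : ℕ) :
    Env n (Function.update ρ x v) (s.setReg (usr x) v) := by
  refine ⟨?_, fun y => ?_⟩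
  · simpa [State.setReg, Function.update, zero_ne_usr] using h.1
  · by_cases hy : y = x
    · simp [State.setReg, hy]
    · simpa [State.setReg, Function.update, usr_inj, hy] using h.2 y

theorem setReg_tmp_tmp (s : State) (k v j : ℕ) :
    (s.setReg (tmp k) v).reg (tmp j) = if j = k then v else s.reg (tmp j) := by
  simp [State.setReg, Function.update, tmp_inj]

theorem setReg_usr_tmp (s : State) (x v j : ℕ) :
    (s.setReg (usr x) v).reg (tmp j) = s.reg (tmp j) := by
  simp [State.setReg, Function.update, tmp_ne_usr]

/-- Induction on the number `m` of remaining rounds. The `8` is four steps for the test and four for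
the increment; `c` is the saved value of the loop variable. -/
theorem runs_loop {n x k : ℕ} {body : Prog} {T : ℕ} {ρ : ℕ → ℕ} {Inv : ℕ → State → Prop} (c : ℕ)
    (hinv : ∀ i s v, Inv i s → Inv i (s.setReg (usr x) v))
    (hbody : ∀ i s, i < n → Env n (Function.update ρ x i) s → Inv i s →
      Runs body s T fun s' => Env n (Function.update ρ x i) s' ∧
        s'.reg (tmp k) = s.reg (tmp k) ∧ Inv (i + 1) s') (m i : ℕ) (hi : i + m = n) {s : State}
    (he : Env n (Function.update ρ x i) s) (hk : s.reg (tmp k) = c) (hs : Inv i s) :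
    Runs (.loop (.sub (.var 0) (.var (usr x)))
      (.seq body (.assign (usr x) (.add (.var (usr x)) (.const 1))))) s (m * (T + 8) + 4)
      fun s' => Env n (Function.update ρ x n) s' ∧ s'.reg (tmp k) = c ∧ Inv n s' := by
  induction m generalizing i s with
  | zero =>
    obtain rfl : i = n := by omega
    refine ⟨_, _, .loopDone ?_, ?_, he, hk, hs⟩
    · have := he.2 x
      simp only [Function.update_self] at this
      simp [Expr.eval, he.1, this]
    · simp [Expr.cost]
  | succ m ih =>
    obtain ⟨t, s', h1, h2, he', hk', hs'⟩ := hbody i s (by omega) he hs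
    have hx := he'.2 x
    simp only [Function.update_self] at hx
    have he'' := he'.setUsr x (i + 1)
    rw [Function.update_idem] at he''
    obtain ⟨t', s'', h1', h2', h3'⟩ := ih (i + 1) (by omega) he''
      (by rw [setReg_usr_tmp, hk', hk]) (hinv _ _ _ hs')
    refine ⟨_, _, .loopStep ?_ (.seq h1 (.assign s' _ _)) (?_ : Exec _ _ t' s''), ?_, h3'⟩
    · have := he.2 x
      simp only [Function.update_self] at this
      simp only [Expr.eval, he.1, this]
      omega
    · simpa [Expr.eval, hx] using h1'
    · simp only [Expr.cost]
      rw [Nat.add_mul, Nat.one_mul]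
      omega

theorem runs_forProg {n x k : ℕ} {body : Prog} {T : ℕ} {ρ : ℕ → ℕ} {Inv : ℕ → State → Prop}
    (hinv : ∀ i s v, Inv i s → Inv i (s.setReg (usr x) v))
    (hinv' : ∀ i s v, Inv i s → Inv i (s.setReg (tmp k) v))
    (hbody : ∀ i s, i < n → Env n (Function.update ρ x i) s → Inv i s →
      Runs body s T fun s' => Env n (Function.update ρ x i) s' ∧
        s'.reg (tmp k) = s.reg (tmp k) ∧ Inv (i + 1) s') {s : State}
    (he : Env n ρ s) (hs : Inv 0 s) :
    Runs (forProg x k body) s (n * (T + 8) + 10) fun s' => Env n ρ s' ∧ Inv n s' := by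
  have key : Runs (forProg x k body) s (2 + (2 + ((n * (T + 8) + 4) + 2)))
      fun s' => Env n ρ s' ∧ Inv n s' := by
    refine Runs.seq (Q := fun s' => Env n ρ s' ∧ s'.reg (tmp k) = ρ x ∧ Inv 0 s')
      (.assign le_rfl ⟨he.setTmp _ _, ?_, hinv' _ _ _ hs⟩) fun s₁ h₁ => ?_
    · simpa [setReg_tmp_tmp, Expr.eval] using he.2 x
    refine Runs.seq (Q := fun s' => Env n (Function.update ρ x 0) s' ∧ s'.reg (tmp k) = ρ x ∧
      Inv 0 s') (.assign le_rfl ⟨h₁.1.setUsr _ _, by rw [setReg_usr_tmp, h₁.2.1],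
        hinv _ _ _ h₁.2.2⟩) fun s₂ h₂ => ?_
    refine Runs.seq (runs_loop (ρ x) hinv hbody n 0 (zero_add n) h₂.1 h₂.2.1 h₂.2.2)
      fun s₃ h₃ => ?_
    refine .assign le_rfl ⟨?_, hinv _ _ _ h₃.2.2⟩
    have := h₃.1.setUsr x (ρ x)
    rw [Function.update_idem, Function.update_eq_self] at this
    simpa [Expr.eval, h₃.2.1] using this
  exact key.mono (by omega) fun _ h => h

open Polynomial in
noncomputable def Tm.time : Tm → ℕ[X]
  | .const _ => 2
  | .var _ => 2
  | .read _ i j => i.time + j.time + 4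
  | .add t u => t.time + u.time + 4
  | .sub t u => t.time + u.time + 4
  | .cond c t u => c.time + t.time + u.time + 2
  | .sum _ t => X * (t.time + 12) + 12

/-- The user arrays have the contents `σ`. -/
def Holds (σ : Mem) (s : State) : Prop := ∀ a, s.arr (loc a) = σ a

/-- The registers `tmp` form a stack: code compiled at level `k` leaves those below `k` alone, so an
operand stored at `k` survives the evaluation of the next one at `k + 1`. -/
theorem Tm.runs_comp (n : ℕ) (σ : Mem) (t : Tm) : ∀ (ρ : ℕ → ℕ) (k : ℕ) (s : State),
    Env n ρ s → Holds σ s → Runs (t.comp k) s (t.time.eval n) fun s' =>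
      Env n ρ s' ∧ s'.arr = s.arr ∧ (∀ j < k, s'.reg (tmp j) = s.reg (tmp j)) ∧
        s'.reg (tmp k) = t.eval n σ ρ := by
  -- The common part of `read`, `add` and `sub`: two operands, then one operation of cost 3.
  have two : ∀ (t u : Tm) (e : ℕ → Expr) (f : ℕ → ℕ → ℕ),
      (∀ k s, Holds σ s → (e k).eval s = f (s.reg (tmp k)) (s.reg (tmp (k + 1)))) →
      (∀ k, (e k).cost = 3) →
      (∀ (ρ : ℕ → ℕ) (k : ℕ) (s : State), Env n ρ s → Holds σ s →
        Runs (t.comp k) s (t.time.eval n) fun s' =>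
        Env n ρ s' ∧ s'.arr = s.arr ∧ (∀ j < k, s'.reg (tmp j) = s.reg (tmp j)) ∧
        s'.reg (tmp k) = t.eval n σ ρ) →
      (∀ (ρ : ℕ → ℕ) (k : ℕ) (s : State), Env n ρ s → Holds σ s →
        Runs (u.comp k) s (u.time.eval n) fun s' =>
        Env n ρ s' ∧ s'.arr = s.arr ∧ (∀ j < k, s'.reg (tmp j) = s.reg (tmp j)) ∧
        s'.reg (tmp k) = u.eval n σ ρ) →
      ∀ (ρ : ℕ → ℕ) (k : ℕ) (s : State), Env n ρ s → Holds σ s →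
      Runs (.seq (t.comp k) <| .seq (u.comp (k + 1)) <| .assign (tmp k) (e k)) s
        (t.time.eval n + (u.time.eval n + 4)) fun s' =>
        Env n ρ s' ∧ s'.arr = s.arr ∧ (∀ j < k, s'.reg (tmp j) = s.reg (tmp j)) ∧
        s'.reg (tmp k) = f (t.eval n σ ρ) (u.eval n σ ρ) := by
    intro t u e f hf hc ht hu ρ k s he hs
    refine (ht ρ k s he hs).seq fun s₁ h₁ => ?_
    have hs₁ : Holds σ s₁ := by intro a; rw [h₁.2.1, hs a]
    refine (hu ρ (k + 1) s₁ h₁.1 hs₁).seq fun s₂ h₂ => ?_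
    have hs₂ : Holds σ s₂ := by intro a; rw [h₂.2.1, hs₁ a]
    refine .assign (by rw [hc]) ⟨h₂.1.setTmp _ _, ?_, fun j hj => ?_, ?_⟩
    · exact h₂.2.1.trans h₁.2.1
    · rw [setReg_tmp_tmp, if_neg (by omega), h₂.2.2.1 j (by omega), h₁.2.2.1 j hj]
    · rw [setReg_tmp_tmp, if_pos rfl, hf k s₂ hs₂, h₂.2.2.2, h₂.2.2.1 k (by omega), h₁.2.2.2]
  induction t with
  | const c =>
    intro ρ k s he hs
    refine .assign (by simp [Tm.time, Expr.cost]) ⟨he.setTmp _ _, rfl, fun j hj => ?_, ?_⟩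
    · rw [setReg_tmp_tmp, if_neg (by omega)]
    · simp [setReg_tmp_tmp, Expr.eval, Tm.eval]
  | var x =>
    intro ρ k s he hs
    refine .assign (by simp [Tm.time, Expr.cost]) ⟨he.setTmp _ _, rfl, fun j hj => ?_, ?_⟩
    · rw [setReg_tmp_tmp, if_neg (by omega)]
    · simp [setReg_tmp_tmp, Expr.eval, Tm.eval, he.2]
  | read a i j ihi ihj =>
    intro ρ k s he hs
    refine (two i j (fun k => .read (loc a) (.var (tmp k)) (.var (tmp (k + 1)))) (σ a)
      (fun k s hs => by simp [Expr.eval, hs a]) (fun k => rfl) ihi ihj ρ k s he hs).mono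
      (by simp [Tm.time]; omega) fun s' h => h
  | add t u iht ihu =>
    intro ρ k s he hs
    refine (two t u (fun k => .add (.var (tmp k)) (.var (tmp (k + 1)))) (· + ·)
      (fun k s hs => by simp [Expr.eval]) (fun k => rfl) iht ihu ρ k s he hs).mono
      (by simp [Tm.time]; omega) fun s' h => h
  | sub t u iht ihu =>
    intro ρ k s he hs
    refine (two t u (fun k => .sub (.var (tmp k)) (.var (tmp (k + 1)))) (· - ·)
      (fun k s hs => by simp [Expr.eval]) (fun k => rfl) iht ihu ρ k s he hs).mono
      (by simp [Tm.time]; omega) fun s' h => h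
  | cond c t u ihc iht ihu =>
    intro ρ k s he hs
    refine Runs.mono (T := c.time.eval n + (2 + (t.time.eval n + u.time.eval n)))
      ((ihc ρ k s he hs).seq fun s₁ h₁ => ?_) (by simp [Tm.time]; omega) fun s' h => h
    have hs₁ : Holds σ s₁ := by intro a; rw [h₁.2.1, hs a]
    by_cases hc : c.eval n σ ρ = 0
    · obtain ⟨t', s₂, h, hT, hQ⟩ := ihu ρ k s₁ h₁.1 hs₁
      refine ⟨_, _, .iteFalse (by simp [Expr.eval, h₁.2.2.2, hc]) h, by simp [Expr.cost]; omega,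
        hQ.1, hQ.2.1.trans h₁.2.1, fun j hj => (hQ.2.2.1 j hj).trans (h₁.2.2.1 j hj), ?_⟩
      simp [Tm.eval, hc, hQ.2.2.2]
    · obtain ⟨t', s₂, h, hT, hQ⟩ := iht ρ k s₁ h₁.1 hs₁
      refine ⟨_, _, .iteTrue (by simp [Expr.eval, h₁.2.2.2, hc]) h, by simp [Expr.cost]; omega,
        hQ.1, hQ.2.1.trans h₁.2.1, fun j hj => (hQ.2.2.1 j hj).trans (h₁.2.2.1 j hj), ?_⟩
      simp [Tm.eval, hc, hQ.2.2.2]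
  | sum x t ih =>
    intro ρ k s he hs
    refine Runs.mono (T := 2 + (n * ((t.time.eval n + 4) + 8) + 10))
      (Q := fun s' => Env n ρ s' ∧ (s'.arr = s.arr ∧ (∀ j < k, s'.reg (tmp j) = s.reg (tmp j)) ∧
        s'.reg (tmp k) = ∑ i ∈ Finset.range n, t.eval n σ (Function.update ρ x i)))
      (Runs.seq (Q := fun s' => Env n ρ s' ∧ s'.arr = s.arr ∧
          (∀ j < k, s'.reg (tmp j) = s.reg (tmp j)) ∧ s'.reg (tmp k) = 0)
        (.assign le_rfl ⟨he.setTmp _ _, rfl, fun j hj => ?_, ?_⟩) fun s₁ h₁ => ?_)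
      (by simp [Tm.time]; ring_nf; omega) fun s' h => h
    · rw [setReg_tmp_tmp, if_neg (by omega)]
    · simp [setReg_tmp_tmp, Expr.eval]
    refine runs_forProg (Inv := fun m s' => s'.arr = s.arr ∧
      (∀ j < k, s'.reg (tmp j) = s.reg (tmp j)) ∧
      s'.reg (tmp k) = ∑ i ∈ Finset.range m, t.eval n σ (Function.update ρ x i)) ?_ ?_ ?_ h₁.1 ?_
    · rintro i s' v ⟨h1, h2, h3⟩
      exact ⟨h1, fun j hj => by rw [setReg_usr_tmp, h2 j hj], by rw [setReg_usr_tmp, h3]⟩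
    · rintro i s' v ⟨h1, h2, h3⟩
      exact ⟨h1, fun j hj => by rw [setReg_tmp_tmp, if_neg (by omega), h2 j hj],
        by rw [setReg_tmp_tmp, if_neg (by omega), h3]⟩
    · rintro i s' hi he' ⟨h1, h2, h3⟩
      refine (ih _ (k + 2) s' he' (fun a => by rw [h1, hs a])).seq fun s₂ h => ?_
      refine .assign le_rfl ⟨h.1.setTmp _ _, ?_, h.2.1.trans h1, fun j hj => ?_, ?_⟩
      · rw [setReg_tmp_tmp, if_neg (by omega), h.2.2.1 _ (by omega)]
      · rw [setReg_tmp_tmp, if_neg (by omega), h.2.2.1 _ (by omega), h2 j hj]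
      · rw [setReg_tmp_tmp, if_pos rfl, Finset.sum_range_succ, ← h3]
        simp [Expr.eval, h.2.2.2, h.2.2.1 k (by omega)]
    · exact ⟨h₁.2.1, h₁.2.2.1, by simpa using h₁.2.2.2⟩

open Polynomial in
noncomputable def Stmt.time : Stmt → ℕ[X]
  | .set _ t => (X * ((X * ((t.time + 4) + 8) + 10) + 8) + 10) +
      (X * ((X * (6 + 8) + 10) + 8) + 10)
  | .seq p q => p.time + q.time
  | .loop _ p => X * (p.time + 8) + 10

theorem Stmt.runs_comp (n : ℕ) (p : Stmt) : ∀ (ρ : ℕ → ℕ) (σ : Mem) (k : ℕ) (s : State),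
    Env n ρ s → Holds σ s → Runs (p.comp k) s (p.time.eval n) fun s' =>
      Env n ρ s' ∧ Holds (p.run n ρ σ) s' ∧ ∀ j < k, s'.reg (tmp j) = s.reg (tmp j) := by
  induction p with
  | seq p q ihp ihq =>
    intro ρ σ k s he hs
    refine ((ihp ρ σ k s he hs).seq fun s₁ h₁ => (ihq ρ _ k s₁ h₁.1 h₁.2.1).mono le_rfl
      fun s₂ h₂ => ⟨h₂.1, h₂.2.1, fun j hj => (h₂.2.2 j hj).trans (h₁.2.2 j hj)⟩).mono
      (by simp [Stmt.time]) fun s' h => h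
  | loop x p ih =>
    intro ρ σ k s he hs
    refine (runs_forProg (T := p.time.eval n) (Inv := fun m s' =>
      Holds (iter (fun i τ => p.run n (Function.update ρ x i) τ) m σ) s' ∧
      ∀ j < k, s'.reg (tmp j) = s.reg (tmp j)) ?_ ?_ ?_ he ⟨hs, fun _ _ => rfl⟩).mono
      (by simp [Stmt.time]) fun s' h => h
    · rintro i s' v ⟨h1, h2⟩
      exact ⟨h1, fun j hj => by rw [setReg_usr_tmp, h2 j hj]⟩
    · rintro i s' v ⟨h1, h2⟩
      exact ⟨h1, fun j hj => by rw [setReg_tmp_tmp, if_neg (by omega), h2 j hj]⟩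
    · rintro i s' hi he' ⟨h1, h2⟩
      refine (ih _ _ (k + 1) s' he' h1).mono le_rfl fun s₂ h => ⟨h.1, h.2.2 k (by omega), h.2.1,
        fun j hj => (h.2.2 j (by omega)).trans (h2 j hj)⟩
  | set a t =>
    intro ρ σ k s he hs
    let f : ℕ → ℕ → ℕ := fun i j => t.eval n σ (cellEnv ρ i j)
    refine Runs.mono (T := (n * ((n * ((t.time.eval n + 4) + 8) + 10) + 8) + 10) +
      (n * ((n * (6 + 8) + 10) + 8) + 10)) (Runs.seq (Q := fun s' => Env n ρ s' ∧ (Holds σ s' ∧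
        (∀ j < k, s'.reg (tmp j) = s.reg (tmp j)) ∧ ∀ i < n, ∀ j < n, s'.arr 2 i j = f i j))
        ?_ fun s₁ h₁ => ?_) (by simp [Stmt.time]) fun s' h => h
    -- First pass: the user arrays keep the contents `σ` while the buffer is filled row by row.
    · refine runs_forProg (Inv := fun m s' => Holds σ s' ∧
        (∀ j < k, s'.reg (tmp j) = s.reg (tmp j)) ∧
        ∀ i < m, ∀ j < n, s'.arr 2 i j = f i j) ?_ ?_ ?_ he ⟨hs, fun _ _ => rfl, by simp⟩
      · rintro i s' v ⟨h1, h2⟩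
        exact ⟨h1, fun j hj => by rw [setReg_usr_tmp, h2.1 j hj], h2.2⟩
      · rintro i s' v ⟨h1, h2⟩
        exact ⟨h1, fun j hj => by rw [setReg_tmp_tmp, if_neg (by omega), h2.1 j hj], h2.2⟩
      · rintro i s' hi he' ⟨h1, h2, h3⟩
        refine (runs_forProg (Inv := fun m s₂ => Holds σ s₂ ∧
          (∀ j < k + 1, s₂.reg (tmp j) = s'.reg (tmp j)) ∧
          (∀ i' < i, ∀ j < n, s₂.arr 2 i' j = f i' j) ∧ ∀ j < m, s₂.arr 2 i j = f i j)
          ?_ ?_ ?_ he' ⟨h1, fun _ _ => rfl, h3, by simp⟩).mono le_rfl ?_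
        · rintro i s' v ⟨h1, h2⟩
          exact ⟨h1, fun j hj => by rw [setReg_usr_tmp, h2.1 j hj], h2.2⟩
        · rintro i s' v ⟨h1, h2⟩
          exact ⟨h1, fun j hj => by rw [setReg_tmp_tmp, if_neg (by omega), h2.1 j hj], h2.2⟩
        · rintro j s₂ hj he₂ ⟨h4, h5, h6, h7⟩
          refine (t.runs_comp n σ _ (k + 2) s₂ he₂ h4).seq fun s₃ h => ?_
          have e0 : s₃.reg (usr 0) = i := by rw [h.1.2]; simp
          have e1 : s₃.reg (usr 1) = j := by rw [h.1.2]; simp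
          refine .write le_rfl ⟨⟨h.1.1, h.1.2⟩, ?_, fun b => ?_, fun j' hj' => ?_, ?_, ?_⟩
          · exact h.2.2.1 _ (by omega)
          · funext i' j'
            simp only [State.setArr, loc_ne_two, false_and, if_false]
            rw [h.2.1, h4]
          · exact (h.2.2.1 _ (by omega)).trans (h5 _ hj')
          · intro i' hi' j' hj'
            simp only [State.setArr, Expr.eval, e0, e1]
            rw [if_neg (by omega), h.2.1, h6 i' hi' j' hj']
          · intro j' hj'
            simp only [State.setArr, Expr.eval, e0, e1]
            by_cases hjj : j' = j
            · subst hjj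
              simp [h.2.2.2, f, cellEnv]
            · rw [if_neg (by omega), h.2.1, h7 j' (by omega)]
        · rintro s₂ ⟨h4, h5, h6, h7, h8⟩
          refine ⟨h4, h6 k (by omega), h5, fun j hj => (h6 j (by omega)).trans (h2 j hj), ?_⟩
          intro i' hi'
          rcases Nat.lt_succ_iff_lt_or_eq.1 hi' with hi' | rfl
          · exact h7 i' hi'
          · exact h8
    -- Second pass: the buffer is fixed, and the rows below `m` of the target are already
    -- overwritten.
    · have key := runs_forProg (n := n) (x := 0) (k := k) (body := forProg 1 (k + 1) <|
        .write (loc a) (.var (usr 0)) (.var (usr 1)) (.read 2 (.var (usr 0)) (.var (usr 1))))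
        (T := n * (6 + 8) + 10) (ρ := ρ) (s := s₁) (Inv := fun m s' =>
        (∀ j < k, s'.reg (tmp j) = s.reg (tmp j)) ∧ s'.arr 2 = s₁.arr 2 ∧
        ∀ b i j, s'.arr (loc b) i j = if b = a ∧ i < m ∧ j < n then f i j else σ b i j)
        ?_ ?_ ?_ h₁.1 ⟨h₁.2.2.1, rfl, fun b i j => by simp [h₁.2.1 b]⟩
      · refine key.mono le_rfl fun s' h => ⟨h.1, fun b => ?_, h.2.1⟩
        funext i j
        exact h.2.2.2 b i j
      · rintro i s' v ⟨h1, h2⟩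
        exact ⟨fun j hj => by rw [setReg_usr_tmp, h1 j hj], h2⟩
      · rintro i s' v ⟨h1, h2⟩
        exact ⟨fun j hj => by rw [setReg_tmp_tmp, if_neg (by omega), h1 j hj], h2⟩
      · rintro i s' hi he' ⟨h1, h2, h3⟩
        refine (runs_forProg (T := 6) (Inv := fun m s₂ =>
          (∀ j < k + 1, s₂.reg (tmp j) = s'.reg (tmp j)) ∧ s₂.arr 2 = s₁.arr 2 ∧
          ∀ b i' j, s₂.arr (loc b) i' j =
            if b = a ∧ (i' < i ∧ j < n ∨ i' = i ∧ j < m) then f i' j else σ b i' j)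
          ?_ ?_ ?_ he' ⟨fun _ _ => rfl, h2, fun b i' j => by simp [h3]⟩).mono le_rfl ?_
        · rintro i s' v ⟨h1, h2⟩
          exact ⟨fun j hj => by rw [setReg_usr_tmp, h1 j hj], h2⟩
        · rintro i s' v ⟨h1, h2⟩
          exact ⟨fun j hj => by rw [setReg_tmp_tmp, if_neg (by omega), h1 j hj], h2⟩
        · rintro j s₂ hj he₂ ⟨h4, h5, h6⟩
          have e0 : s₂.reg (usr 0) = i := by rw [he₂.2]; simp
          have e1 : s₂.reg (usr 1) = j := by rw [he₂.2]; simp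
          refine .write le_rfl ⟨⟨he₂.1, he₂.2⟩, rfl, h4, ?_, fun b i' j' => ?_⟩
          · funext i' j'
            simp [State.setArr, (loc_ne_two a).symm, h5]
          · simp only [State.setArr, Expr.eval, e0, e1, loc_inj, h5, h₁.2.2.2 i hi j hj, h6]
            by_cases hh : b = a ∧ i' = i ∧ j' = j
            · obtain ⟨rfl, rfl, rfl⟩ := hh
              simp
            · rw [if_neg hh]
              refine if_congr ?_ rfl rfl
              omega
        · rintro s₂ ⟨h4, h5, h6, h7⟩
          refine ⟨h4, h5 k (by omega), fun j hj => (h5 j (by omega)).trans (h1 j hj), h6, ?_⟩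
          intro b i' j'
          rw [h7]
          refine if_congr ?_ rfl rfl
          omega

/-- Bounded loop programs run in polynomial time on the machine. -/
theorem Stmt.exec_input (p : Stmt) {n : ℕ} (G : Graph n) : ∃ t s,
    Exec (p.comp 0) (input G) t s ∧ t ≤ p.time.eval n ∧
      ∀ i j, s.arr 1 i j = p.run n (fun _ => 0) (fun a => (input G).arr (loc a)) 1 i j := by
  obtain ⟨t, s, h1, h2, h3⟩ := p.runs_comp n (fun _ => 0) (fun a => (input G).arr (loc a)) 0
    (input G) ⟨by simp [input], fun x => by simp [input, usr]⟩ fun a => rfl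
  refine ⟨t, s, h1, h2, fun i j => ?_⟩
  rw [← h3.2.1 1]
  rfl

end BoundedLanguage

/-! ### Feedback vertex sets in incidence graphs with the weights `deg - 1`. -/

section Hypergraphs

open Finset

set_option linter.unusedSectionVars false

variable {V K : Type*} [DecidableEq V] [DecidableEq K] (I : V → K → Prop) [∀ v k, Decidable (I v k)]

/-- The number of lines through a point. -/
def deg (L : Finset K) (v : V) : ℕ := #{k ∈ L | I v k}

/-- The incidence graph of the points `X` and the lines `L` is a forest: every nonempty set `Y` of
points has a point with at most one line to the others. -/
def Elim (L : Finset K) (X : Finset V) : Prop :=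
  ∀ Y ⊆ X, Y.Nonempty → ∃ v ∈ Y, #{k ∈ L | I v k ∧ ∃ y ∈ Y, y ≠ v ∧ I y k} ≤ 1

/-- `φ` labels the lines by the connected components of the forest on `X` and `L`. -/
structure IsLabel (L : Finset K) (X : Finset V) (φ : K → K) : Prop where
  const : ∀ x ∈ X, ∀ k ∈ L, ∀ k' ∈ L, I x k → I x k' → φ k = φ k'
  finest : ∀ ψ : K → Prop, (∀ x ∈ X, ∀ k ∈ L, ∀ k' ∈ L, I x k → I x k' → (ψ k ↔ ψ k')) →
    ∀ k ∈ L, ∀ k' ∈ L, φ k = φ k' → (ψ k ↔ ψ k')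
  card : ∀ k ∈ L, #{k' ∈ L | φ k' = φ k} =
    1 + ∑ x ∈ X with ∃ k' ∈ L, I x k' ∧ φ k' = φ k, (deg I L x - 1)

variable {I} {L : Finset K} {X : Finset V} {φ : K → K}

theorem Elim.mono (h : Elim I L X) {L' : Finset K} {X' : Finset V} (hL : L' ⊆ L) (hX : X' ⊆ X) :
    Elim I L' X' := by
  intro Y hY hne
  obtain ⟨v, hv, hc⟩ := h Y (hY.trans hX) hne
  exact ⟨v, hv, (card_le_card (filter_subset_filter _ hL)).trans hc⟩

/-- Induction on `X`: `Elim` supplies a point `v` that meets the other points on at most one line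
`a`. The other lines of `v` are isolated without `v`, and adding `v` merges them into the class of
`a`. -/
theorem Elim.exists_isLabel (X : Finset V) : Elim I L X → (∀ x ∈ X, 1 ≤ deg I L x) →
    ∃ φ, IsLabel I L X φ := by
  induction X using Finset.strongInduction with
  | H X ih =>
  intro h hd
  rcases X.eq_empty_or_nonempty with rfl | hne
  · refine ⟨fun k => k, by simp, ?_, ?_⟩
    · rintro ψ - k - k' - rfl
      exact Iff.rfl
    · intro k hk
      simp [filter_eq', hk]
  obtain ⟨v, hv, hc⟩ := h X Subset.rfl hne
  obtain ⟨φ, h1, h2, h3⟩ := ih (X.erase v) (erase_ssubset hv) (h.mono Subset.rfl (erase_subset _ _))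
    fun x hx => hd x (mem_of_mem_erase hx)
  -- If `v` shares no line at all, any line through `v` can serve as `a`; this is where positive
  -- degree is needed.
  obtain ⟨a, ha, hva, hiso⟩ : ∃ a ∈ L, I v a ∧
      ∀ k ∈ L, I v k → k ≠ a → ∀ x ∈ X.erase v, ¬ I x k := by
    obtain ⟨b, hb⟩ := card_pos.1 (hd v hv)
    rw [mem_filter] at hb
    have : Nonempty K := ⟨b⟩
    rcases card_le_one_iff_subset_singleton.1 hc with ⟨a, ha⟩
    by_cases haL : a ∈ L ∧ I v a
    · refine ⟨a, haL.1, haL.2, fun k hk hvk hka x hx hxk => hka ?_⟩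
      have := ha (mem_filter.2 ⟨hk, hvk, x, mem_of_mem_erase hx, ne_of_mem_erase hx, hxk⟩)
      exact mem_singleton.1 this
    · refine ⟨b, hb.1, hb.2, fun k hk hvk _ x hx hxk => haL ?_⟩
      have := ha (mem_filter.2 ⟨hk, hvk, x, mem_of_mem_erase hx, ne_of_mem_erase hx, hxk⟩)
      rw [mem_singleton] at this
      exact this ▸ ⟨hk, hvk⟩
  have hsing : ∀ k ∈ L, I v k → k ≠ a → ∀ k' ∈ L, φ k = φ k' → k' = k := by
    intro k hk hvk hka k' hk' he
    refine (h2 (· = k) ?_ k hk k' hk' he).1 rfl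
    intro x hx l hl l' hl' hxl hxl'
    refine iff_of_false ?_ ?_
    · rintro rfl
      exact hiso _ hl hvk hka x hx hxl
    · rintro rfl
      exact hiso _ hl' hvk hka x hx hxl'
  have hφ : ∀ x ∈ X.erase v, ∀ k ∈ L, I x k → (if I v k then φ a else φ k) = φ k := by
    intro x hx k hk hxk
    split_ifs with hvk
    · by_cases hka : k = a
      · rw [hka]
      · exact absurd hxk (hiso k hk hvk hka x hx)
    · rfl
  refine ⟨fun k => if I v k then φ a else φ k, ?_, ?_, ?_⟩
  · intro x hx k hk k' hk' hxk hxk'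
    by_cases hxv : x = v
    · subst hxv
      simp [hxk, hxk']
    · have hx' := mem_erase.2 ⟨hxv, hx⟩
      simp only [hφ x hx' k hk hxk, hφ x hx' k' hk' hxk']
      exact h1 x hx' k hk k' hk' hxk hxk'
  · intro ψ hψ
    have base := h2 ψ fun x hx => hψ x (mem_of_mem_erase hx)
    intro k hk k' hk' he
    split_ifs at he with hvk hvk' hvk'
    · exact hψ v hv k hk k' hk' hvk hvk'
    · exact (hψ v hv k hk a ha hvk hva).trans (base a ha k' hk' he)
    · exact (base k hk a ha he).trans (hψ v hv a ha k' hk' hva hvk')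
    · exact base k hk k' hk' he
  · intro k hk
    have hset : ∀ c, (X.erase v).filter (fun x => ∃ k' ∈ L, I x k' ∧
        (if I v k' then φ a else φ k') = c) =
        (X.erase v).filter (fun x => ∃ k' ∈ L, I x k' ∧ φ k' = c) := by
      intro c
      refine filter_congr fun x hx => ?_
      constructor
      · rintro ⟨k', hk', hxk', he⟩
        exact ⟨k', hk', hxk', by rw [← he, hφ x hx k' hk' hxk']⟩
      · rintro ⟨k', hk', hxk', he⟩
        exact ⟨k', hk', hxk', by rw [← he, hφ x hx k' hk' hxk']⟩
    -- Only the class of `a` changes: it gains the point `v` and the `deg v - 1` other lines of `v`.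
    by_cases hka : (if I v k then φ a else φ k) = φ a
    · simp only [hka]
      have e1 : {k' ∈ L | (if I v k' then φ a else φ k') = φ a} =
          {k' ∈ L | φ k' = φ a} ∪ ({k' ∈ L | I v k'}.erase a) := by
        ext k'
        simp only [mem_filter, mem_union, mem_erase]
        by_cases hvk : I v k'
        · simp only [hvk, if_true, and_true]
          by_cases hk'a : k' = a <;> simp [hk'a, ha]
          exact fun h _ => h
        · simp [hvk]
      have e2 : X.filter (fun x => ∃ k' ∈ L, I x k' ∧ (if I v k' then φ a else φ k') = φ a) =
          insert v ((X.erase v).filter (fun x => ∃ k' ∈ L, I x k' ∧ φ k' = φ a)) := by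
        rw [← hset]
        conv_lhs => rw [← insert_erase hv]
        rw [filter_insert, if_pos ⟨a, ha, hva, by simp⟩]
      rw [e1, e2, card_union_of_disjoint, sum_insert (by simp), h3 a ha,
        card_erase_of_mem (mem_filter.2 ⟨ha, hva⟩)]
      · change _ + (deg I L v - 1) = _
        omega
      · rw [disjoint_left]
        intro k' hk' hk''
        simp only [mem_filter, mem_erase] at hk' hk''
        exact hk''.1 (hsing k' hk''.2.1 hk''.2.2 hk''.1 a ha hk'.2).symm
    · have hvk : ¬ I v k := fun h => hka (if_pos h)
      rw [if_neg hvk] at hka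
      simp only [hvk, if_false]
      have e1 : {k' ∈ L | (if I v k' then φ a else φ k') = φ k} = {k' ∈ L | φ k' = φ k} := by
        refine filter_congr fun k' hk' => ?_
        split_ifs with hvk'
        · refine iff_of_false (Ne.symm hka) fun he => ?_
          by_cases hk'a : k' = a
          · exact hka (by rw [← he, hk'a])
          · exact hvk (hsing k' hk' hvk' hk'a k hk he ▸ hvk')
        · rfl
      have e2 : X.filter (fun x => ∃ k' ∈ L, I x k' ∧ (if I v k' then φ a else φ k') = φ k) =
          ((X.erase v).filter (fun x => ∃ k' ∈ L, I x k' ∧ φ k' = φ k)) := by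
        rw [← hset]
        conv_lhs => rw [← insert_erase hv]
        rw [filter_insert, if_neg]
        rintro ⟨k', hk', hvk', he⟩
        rw [if_pos hvk'] at he
        exact hka he.symm
      rw [e1, e2, h3 k hk]

theorem IsLabel.class_iff (h : IsLabel I L X φ) {x : V} (hx : x ∈ X) {k : K} (hk : k ∈ L)
    (hxk : I x k) (c : K) : (∃ k' ∈ L, I x k' ∧ φ k' = c) ↔ φ k = c := by
  constructor
  · rintro ⟨k', hk', hxk', rfl⟩
    exact h.const x hx k hk k' hk' hxk hxk'
  · exact fun h => ⟨k, hk, hxk, h⟩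

/-- Euler's formula for forests: each point belongs to exactly one component, so the identities
`card` of the single trees add up. -/
theorem IsLabel.card_image (h : IsLabel I L X φ) (hd : ∀ x ∈ X, 1 ≤ deg I L x) :
    ∑ x ∈ X, (deg I L x - 1) + #(L.image φ) = #L := by
  rcases L.eq_empty_or_nonempty with rfl | ⟨b, -⟩
  · simp [deg]
  have hg : ∀ x ∈ X, ∃ k, k ∈ L ∧ I x k := fun x hx => by
    obtain ⟨b, hb⟩ := card_pos.1 (hd x hx)
    exact ⟨b, mem_filter.1 hb⟩
  have : Nonempty K := ⟨b⟩
  choose! g hg using hg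
  have hmaps : ∀ x ∈ X, φ (g x) ∈ L.image φ := fun x hx => mem_image_of_mem _ (hg x hx).1
  rw [card_eq_sum_card_image φ L, ← sum_fiberwise_of_maps_to hmaps, card_eq_sum_ones (L.image φ),
    ← sum_add_distrib]
  refine sum_congr rfl fun c hc => ?_
  obtain ⟨k, hk, rfl⟩ := mem_image.1 hc
  rw [h.card k hk, add_comm]
  congr 1
  refine sum_congr (filter_congr fun x hx => ?_) fun _ _ => rfl
  exact (h.class_iff hx (hg x hx).1 (hg x hx).2 _).symm

/-- A point whose addition to a forest creates a cycle has two lines in one component. -/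
theorem IsLabel.exists_eq (h : IsLabel I L X φ) (hX : Elim I L X) {v : V} (hv : v ∉ X)
    (hc : ¬ Elim I L (insert v X)) :
    ∃ k ∈ L, ∃ k' ∈ L, k ≠ k' ∧ I v k ∧ I v k' ∧ φ k = φ k' := by
  by_contra! hcon
  -- The failure of `Elim` yields a configuration without leaves. It contains `v` because `X` is a
  -- forest.
  obtain ⟨Y, hY, hne, hcore⟩ : ∃ Y ⊆ insert v X, Y.Nonempty ∧
      ∀ y ∈ Y, 2 ≤ #{k ∈ L | I y k ∧ ∃ z ∈ Y, z ≠ y ∧ I z k} := by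
    simp only [Elim, not_forall, not_exists, not_and, not_le] at hc
    obtain ⟨Y, hY, hne, hcore⟩ := hc
    exact ⟨Y, hY, hne, hcore⟩
  have hvY : v ∈ Y := by
    by_contra hvY
    have hYX : Y ⊆ X := fun y hy => (mem_insert.1 (hY hy)).resolve_left (by rintro rfl; exact hvY hy)
    obtain ⟨y, hy, hy'⟩ := hX Y hYX hne
    exact absurd (hcore y hy) (by omega)
  have hYX : Y.erase v ⊆ X := fun y hy =>
    (mem_insert.1 (hY (mem_of_mem_erase hy))).resolve_left (ne_of_mem_erase hy)
  set M := {k ∈ L | 2 ≤ #{y ∈ Y | I y k}} with hM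
  have hML : M ⊆ L := filter_subset _ _
  have hdeg : ∀ y ∈ Y, 2 ≤ deg I M y := by
    intro y hy
    refine (hcore y hy).trans (card_le_card fun k hk => ?_)
    simp only [mem_filter] at hk
    obtain ⟨hk, hyk, z, hz, hzy, hzk⟩ := hk
    refine mem_filter.2 ⟨mem_filter.2 ⟨hk, ?_⟩, hyk⟩
    exact one_lt_card.2 ⟨z, mem_filter.2 ⟨hz, hzk⟩, y, mem_filter.2 ⟨hy, hyk⟩, hzy⟩
  have hd' : ∀ x ∈ Y.erase v, 1 ≤ deg I M x := fun x hx =>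
    le_trans (by norm_num) (hdeg x (mem_of_mem_erase hx))
  obtain ⟨χ, hχ⟩ := Elim.exists_isLabel (Y.erase v) (hX.mono hML hYX) hd'
  -- The classes of `χ` refine those of `φ`, so by assumption the lines through `v` lie in different
  -- classes of `χ`.
  have hle : deg I M v ≤ #(M.image χ) := by
    rw [deg, ← card_image_of_injOn (s := {k ∈ M | I v k}) (f := χ)]
    · exact card_le_card (image_subset_image (filter_subset _ _))
    · intro k hk k' hk' he
      have hk := mem_filter.1 (mem_coe.1 hk)
      have hk' := mem_filter.1 (mem_coe.1 hk')
      by_contra hkk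
      refine hcon k (hML hk.1) k' (hML hk'.1) hkk hk.2 hk'.2 ?_
      refine ((hχ.finest (fun l => φ k = φ l) ?_ k hk.1 k' hk'.1 he).1 rfl)
      intro x hx l hl l' hl' hxl hxl'
      rw [h.const x (hYX hx) l (hML hl) l' (hML hl') hxl hxl']
  -- With d the degrees in `M`, Euler's formula and `hle` give #M ≥ Σ_Y d - #Y + 1. Since 2#Y ≤ Σ_Y
  -- d, this makes 2#M exceed Σ_Y d, against the double count 2#M ≤ Σ_Y d.
  have hcard := hχ.card_image hd'
  have hsum : ∑ y ∈ Y, deg I M y = ∑ k ∈ M, #{y ∈ Y | I y k} :=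
    sum_card_bipartiteAbove_eq_sum_card_bipartiteBelow I
  have h1 : 2 * #M ≤ ∑ k ∈ M, #{y ∈ Y | I y k} := by
    rw [mul_comm, ← smul_eq_mul]
    exact card_nsmul_le_sum _ _ _ fun k hk => (mem_filter.1 hk).2
  have h2 : ∑ y ∈ Y, (deg I M y - 1) + #Y = ∑ y ∈ Y, deg I M y := by
    rw [card_eq_sum_ones, ← sum_add_distrib]
    exact sum_congr rfl fun y hy => Nat.sub_add_cancel (le_trans (by norm_num) (hdeg y hy))
  have h3 : #Y ≤ ∑ y ∈ Y, (deg I M y - 1) := by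
    rw [card_eq_sum_ones]
    exact sum_le_sum fun y hy => by have := hdeg y hy; omega
  have h4 := add_sum_erase Y (fun y => deg I M y - 1) hvY
  have h5 := hdeg v hvY
  omega

/-- Every component of the complement of `F` sends at least two edges to `F`. -/
theorem IsLabel.two_le_sum {A F : Finset V} (hF : F ⊆ A) (h : IsLabel I L (A \ F) φ)
    (hA : ∀ v ∈ A, 2 ≤ deg I L v) (hL : ∀ k ∈ L, 2 ≤ #{v ∈ A | I v k}) {k : K} (hk : k ∈ L) :
    2 ≤ ∑ v ∈ F, #{k' ∈ L | I v k' ∧ φ k' = φ k} := by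
  -- For a component with lines `C` and points `Z`, the lines carry at least 2#C incidences, of
  -- which `Z` accounts for Σ_Z deg. As #C = 1 + Σ_Z (deg - 1), at least 2 + Σ_Z (deg - 2) ≥ 2 are
  -- left for `F`.
  set C := {k' ∈ L | φ k' = φ k} with hC
  set Z := {x ∈ A \ F | ∃ k' ∈ L, I x k' ∧ φ k' = φ k} with hZ
  have h1 : 2 * #C ≤ ∑ k' ∈ C, #{v ∈ A | I v k'} := by
    rw [mul_comm, ← smul_eq_mul]
    exact card_nsmul_le_sum _ _ _ fun k hk => hL k (mem_filter.1 hk).1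
  have h2 : ∑ v ∈ A, deg I C v = ∑ k' ∈ C, #{v ∈ A | I v k'} :=
    sum_card_bipartiteAbove_eq_sum_card_bipartiteBelow I
  have h3 : ∑ v ∈ A \ F, deg I C v = ∑ x ∈ Z, deg I L x := by
    rw [hZ, sum_filter]
    refine sum_congr rfl fun x hx => ?_
    split_ifs with hxk
    · obtain ⟨l, hl, hxl, he⟩ := hxk
      refine congrArg Finset.card (?_ : {k' ∈ C | I x k'} = {k' ∈ L | I x k'})
      ext k'
      simp only [hC, mem_filter]
      exact ⟨fun h => ⟨h.1.1, h.2⟩, fun h' => ⟨⟨h'.1, (h.const x hx k' h'.1 l hl h'.2 hxl).trans he⟩,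
        h'.2⟩⟩
    · refine card_eq_zero.2 (filter_eq_empty_iff.2 fun k' hk' hxk' => hxk ?_)
      exact ⟨k', (mem_filter.1 hk').1, hxk', (mem_filter.1 hk').2⟩
  have h4 : ∑ v ∈ F, deg I C v = ∑ v ∈ F, #{k' ∈ L | I v k' ∧ φ k' = φ k} := by
    refine sum_congr rfl fun v _ => ?_
    rw [deg, hC, filter_filter]
    simp only [and_comm]
  have h5 := sum_sdiff hF (f := deg I C)
  have h6 : #C = 1 + ∑ x ∈ Z, (deg I L x - 1) := h.card k hk
  have hZA : ∀ x ∈ Z, 2 ≤ deg I L x := fun x hx => hA x (mem_sdiff.1 (mem_filter.1 hx).1).1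
  have h7 : ∑ x ∈ Z, (deg I L x - 1) + #Z = ∑ x ∈ Z, deg I L x := by
    rw [card_eq_sum_ones, ← sum_add_distrib]
    exact sum_congr rfl fun y hy => Nat.sub_add_cancel (le_trans (by norm_num) (hZA y hy))
  have h8 : #Z ≤ ∑ x ∈ Z, (deg I L x - 1) := by
    rw [card_eq_sum_ones]
    exact sum_le_sum fun y hy => by have := hZA y hy; omega
  omega

/-- With the weights `deg - 1`, a feedback vertex set all of whose vertices have a private cycle is
at most four times as heavy as any other feedback vertex set. -/
theorem sum_deg_le {A F F' : Finset V} (hA : ∀ v ∈ A, 2 ≤ deg I L v)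
    (hL : ∀ k ∈ L, 2 ≤ #{v ∈ A | I v k}) (hF : F ⊆ A) (hE : Elim I L (A \ F))
    (hmin : ∀ v ∈ F, ¬ Elim I L (insert v (A \ F))) (hF' : F' ⊆ A) (hE' : Elim I L (A \ F')) :
    ∑ v ∈ F, (deg I L v - 1) ≤ 4 * ∑ v ∈ F', (deg I L v - 1) := by
  have hd : ∀ S : Finset V, ∀ x ∈ A \ S, 1 ≤ deg I L x := fun S x hx =>
    le_trans (by norm_num) (hA x (mem_sdiff.1 hx).1)
  obtain ⟨φ, hφ⟩ := Elim.exists_isLabel _ hE (hd F)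
  obtain ⟨χ, hχ⟩ := Elim.exists_isLabel _ hE' (hd F')
  -- `m v c` counts the edges from `v` to the component `c` of the forest on `A \ F`, and `e c` all
  -- edges from `F` to it.
  let m : V → K → ℕ := fun v c => #{k ∈ L | I v k ∧ φ k = c}
  let e : K → ℕ := fun c => ∑ v ∈ F, m v c
  have he : ∀ c ∈ L.image φ, 2 ≤ e c := by
    intro c hc
    obtain ⟨k, hk, rfl⟩ := mem_image.1 hc
    exact hφ.two_le_sum hF hA hL hk
  have hm : ∀ v, ∑ c ∈ L.image φ, m v c = deg I L v := by
    intro v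
    rw [deg, card_eq_sum_card_fiberwise (f := φ) (t := L.image φ)
      fun k hk => mem_image_of_mem _ (mem_filter.1 hk).1]
    simp only [m, filter_filter]
  rcases L.eq_empty_or_nonempty with rfl | ⟨b, -⟩
  · simp [deg]
  have : Nonempty K := ⟨b⟩
  -- By minimality each `v` in `F` has a home component, that of the line `p v`, to which it sends
  -- two edges.
  have hp : ∀ v ∈ F, ∃ k, k ∈ L ∧ I v k ∧ 2 ≤ m v (φ k) := by
    intro v hv
    obtain ⟨k, hk, k', hk', hne, hvk, hvk', heq⟩ := hφ.exists_eq hE (fun h => (mem_sdiff.1 h).2 hv)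
      (hmin v hv)
    exact ⟨k, hk, hvk, one_lt_card.2 ⟨k, mem_filter.2 ⟨hk, hvk, rfl⟩, k',
      mem_filter.2 ⟨hk', hvk', heq.symm⟩, hne⟩⟩
  choose! p hpL hpI hpm using hp
  have hep : ∀ v ∈ F, φ (p v) ∈ L.image φ := fun v hv => mem_image_of_mem _ (hpL v hv)
  have hown : ∀ c, 2 * #{v ∈ F | φ (p v) = c} ≤ e c := by
    intro c
    calc 2 * #{v ∈ F | φ (p v) = c} ≤ ∑ v ∈ F with φ (p v) = c, m v c := by
          rw [mul_comm, ← smul_eq_mul]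
          refine card_nsmul_le_sum _ _ _ fun v hv => ?_
          obtain ⟨hv, hvc⟩ := mem_filter.1 hv
          rw [← hvc]
          exact hpm v hv
      _ ≤ e c := sum_le_sum_of_subset (filter_subset _ _)
  -- For these vertices the home component and `v` form an isolated cycle, the tight case of the
  -- charging.
  set Q := {v ∈ F | deg I L v = 2 ∧ e (φ (p v)) = 2} with hQ
  -- the components of `A \ F` are few
  have hup : 4 * #(L.image φ) ≤ 3 * ∑ v ∈ F, (deg I L v - 1) + #Q := by
    -- At most half of `e c` vertices have their home at `c`. If `e c = 2` the correction term pays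
    -- for them; if `e c = 3` there is at most one and 5 ≤ 6; from 4 on there is enough slack.
    have h1 : ∀ c ∈ L.image φ, #{v ∈ F | φ (p v) = c} + 4 ≤
        2 * e c + ∑ v ∈ F with φ (p v) = c, (if e (φ (p v)) = 2 then 1 else 0) := by
      intro c hc
      have h2 : ∑ v ∈ F with φ (p v) = c, (if e (φ (p v)) = 2 then 1 else 0) =
          #{v ∈ F | φ (p v) = c} * (if e c = 2 then 1 else 0) := by
        rw [← smul_eq_mul, ← sum_const]
        exact sum_congr rfl fun v hv => by rw [(mem_filter.1 hv).2]
      rw [h2]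
      have := he c hc
      have := hown c
      split_ifs <;> omega
    have h2 := sum_le_sum h1
    rw [sum_add_distrib, sum_add_distrib, sum_const, ← mul_sum,
      sum_fiberwise_of_maps_to (f := fun v => if e (φ (p v)) = 2 then 1 else 0) hep,
      ← card_eq_sum_card_fiberwise hep, sum_comm] at h2
    simp only [hm] at h2
    -- A degree of at least three absorbs the correction; at degree two the bound is tight, and the
    -- correction survives exactly on `Q`.
    have h3 : ∀ v ∈ F, 2 * deg I L v + (if e (φ (p v)) = 2 then 1 else 0) ≤
        3 * (deg I L v - 1) + 1 + (if deg I L v = 2 ∧ e (φ (p v)) = 2 then 1 else 0) := by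
      intro v hv
      have := hA v (hF hv)
      by_cases h5 : e (φ (p v)) = 2 <;> by_cases h6 : deg I L v = 2 <;> simp [h5, h6] <;> omega
    have h4 := sum_le_sum h3
    rw [sum_add_distrib, sum_add_distrib, sum_add_distrib, ← mul_sum, ← mul_sum,
      sum_const, ← card_filter _ F, ← card_filter _ F] at h4
    rw [← card_filter _ F] at h2
    simp only [smul_eq_mul, mul_one, ← hQ] at h2 h4
    omega
  -- isolated cycles are in different components of `A \ F'`
  have hlow : #Q ≤ #(L.image χ) := by
    refine card_le_card_of_injOn (fun v => χ (p v)) (fun v hv => ?_) ?_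
    · exact mem_image_of_mem _ (hpL v (mem_filter.1 hv).1)
    · intro v hv w hw heq
      obtain ⟨hvF, hv2, hve⟩ := mem_filter.1 hv
      obtain ⟨hwF, hw2, hwe⟩ := mem_filter.1 hw
      have hothers : ∀ x ∈ F, x ≠ v → m x (φ (p v)) = 0 := by
        intro x hx hxv
        have h1 := add_sum_erase F (fun x => m x (φ (p v))) hvF
        have h2 := single_le_sum (f := fun x => m x (φ (p v))) (fun _ _ => Nat.zero_le _)
          (mem_erase.2 ⟨hxv, hx⟩)
        have h3 := hpm v hvF
        change _ = e _ at h1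
        omega
      -- The home component of `v` is closed under all points of `A`: no other point of `F` touches
      -- it, and both lines of `v` lie in it. So `χ` cannot connect it to the home of another vertex
      -- of `Q`.
      have key := (hχ.finest (fun k => φ k = φ (p v)) ?_ (p v) (hpL v hvF) (p w) (hpL w hwF)
        heq).1 rfl
      · by_contra hne
        have h1 := hothers w hwF (Ne.symm hne)
        have h2 := hpm w hwF
        rw [key] at h2
        omega
      · intro x hx k hk k' hk' hxk hxk'
        have hxA := (mem_sdiff.1 hx).1
        by_cases hxF : x ∈ F
        · by_cases hxv : x = v
          · subst hxv
            have hall : {k ∈ L | I x k ∧ φ k = φ (p x)} = {k ∈ L | I x k} :=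
              eq_of_subset_of_card_le (fun k hk => by
                rw [mem_filter] at hk ⊢
                exact ⟨hk.1, hk.2.1⟩) (hv2.le.trans (hpm x hxF))
            have hin : ∀ k ∈ L, I x k → φ k = φ (p x) := fun k hk hxk =>
              (mem_filter.1 (hall.symm ▸ mem_filter.2 ⟨hk, hxk⟩ :
                k ∈ {k ∈ L | I x k ∧ φ k = φ (p x)})).2.2
            exact iff_of_true (hin k hk hxk) (hin k' hk' hxk')
          · have h0 := filter_eq_empty_iff.1 (card_eq_zero.1 (hothers x hxF hxv))
            exact iff_of_false (fun h => h0 hk ⟨hxk, h⟩) fun h => h0 hk' ⟨hxk', h⟩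
        · rw [hφ.const x (mem_sdiff.2 ⟨hxA, hxF⟩) k hk k' hk' hxk hxk']
  -- Euler's formula for `F` and for `F'` equates the two differences between weight and number of
  -- components; `hup` and `hlow` then give the factor four.
  have h1 := hφ.card_image (hd F)
  have h2 := hχ.card_image (hd F')
  have h3 := sum_sdiff hF (f := fun v => deg I L v - 1)
  have h4 := sum_sdiff hF' (f := fun v => deg I L v - 1)
  omega

end Hypergraphs

/-! ### Block graphs, simplicial vertices and the hypergraph of maximal cliques. -/

section BlockGraphs

open Finset

set_option linter.unusedSectionVars false

variable {V : Type*} (G : SimpleGraph V)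

/-- The neighbours of `v` in `Y` form a clique. -/
def Simplicial (Y : Finset V) (v : V) : Prop :=
  ∀ x ∈ Y, ∀ y ∈ Y, G.Adj v x → G.Adj v y → x ≠ y → G.Adj x y

/-- Every nonempty subset of `A` has a simplicial vertex. -/
def Dismantlable (A : Finset V) : Prop :=
  ∀ Y ⊆ A, Y.Nonempty → ∃ v ∈ Y, Simplicial G Y v

/-- There are no induced cycles of length four and no induced diamonds in `A`. -/
def Good (A : Finset V) : Prop :=
  ∀ a ∈ A, ∀ b ∈ A, ∀ c ∈ A, ∀ d ∈ A, G.Adj a b → G.Adj b c → G.Adj c d → G.Adj d a → a ≠ c →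
    b ≠ d → G.Adj a c

/-- The two-connected subgraphs on vertices of `A` are cliques. -/
def CliqueBlocks (A : Finset V) : Prop :=
  ∀ B ⊆ A, IsTwoConnected G (B : Set V) → G.IsClique (B : Set V)

variable {G}

theorem Good.mono {A B : Finset V} (h : Good G A) (hB : B ⊆ A) : Good G B :=
  fun a ha b hb c hc d hd => h a (hB ha) b (hB hb) c (hB hc) d (hB hd)

theorem Dismantlable.mono {A B : Finset V} (h : Dismantlable G A) (hB : B ⊆ A) :
    Dismantlable G B := fun Y hY => h Y (hY.trans hB)

/-- Connectivity in terms of cuts, which stays within sets of vertices of `V` when vertices are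
deleted. -/
theorem connected_induce_iff (S : Set V) : (G.induce S).Connected ↔
    S.Nonempty ∧ ∀ X ⊆ S, X.Nonempty → (S \ X).Nonempty → ∃ x ∈ X, ∃ y ∈ S \ X, G.Adj x y := by
  constructor
  · intro h
    refine ⟨?_, ?_⟩
    · obtain ⟨x⟩ := h.nonempty
      exact ⟨x.1, x.2⟩
    · rintro X hX ⟨a, ha⟩ ⟨b, hb, hbX⟩
      obtain ⟨p⟩ := h.preconnected ⟨a, hX ha⟩ ⟨b, hb⟩
      obtain ⟨d, -, h1, h2⟩ := p.exists_boundary_dart {x | x.1 ∈ X} ha hbX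
      exact ⟨d.fst.1, h1, d.snd.1, ⟨d.snd.2, h2⟩, d.adj⟩
  · rintro ⟨⟨u, hu⟩, h⟩
    have key : ∀ v : S, (G.induce S).Reachable ⟨u, hu⟩ v := by
      by_contra! hv
      obtain ⟨v, hv⟩ := hv
      obtain ⟨x, ⟨hxS, hx⟩, y, ⟨hyS, hy⟩, hxy⟩ := h
        {x | ∃ hx : x ∈ S, (G.induce S).Reachable ⟨u, hu⟩ ⟨x, hx⟩} (fun x hx => hx.1)
        ⟨u, hu, .refl _⟩ ⟨v, v.2, fun hv' => hv hv'.2⟩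
      refine hy ⟨hyS, hx.trans (SimpleGraph.Adj.reachable ?_)⟩
      exact hxy
    have : Nonempty S := ⟨⟨u, hu⟩⟩
    exact ⟨fun a b => (key a).symm.trans (key b)⟩

theorem not_connected_induce {S : Set V} (hS : S.Nonempty) (h : ¬ (G.induce S).Connected) :
    ∃ X ⊆ S, X.Nonempty ∧ (S \ X).Nonempty ∧ ∀ x ∈ X, ∀ y ∈ S \ X, ¬ G.Adj x y := by
  rw [connected_induce_iff] at h
  push Not at h
  obtain ⟨X, h1, h2, h3, h4⟩ := h hS
  exact ⟨X, h1, h2, h3, h4⟩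

/-- In the absence of induced diamonds and four-cycles, dismantlable graphs are block graphs. -/
theorem cliqueBlocks_of_dismantlable [DecidableEq V] {A : Finset V} (hg : Good G A)
    (hd : Dismantlable G A) : CliqueBlocks G A := by
  intro B
  induction B using Finset.strongInduction with
  | H B ih =>
  intro hBA hB
  obtain ⟨h3, hconn, hcut⟩ := hB
  rw [Set.encard_coe_eq_coe_finsetCard] at h3
  have h3 : 2 < #B := by exact_mod_cast h3
  obtain ⟨v, hv, hs⟩ := hd B hBA (card_pos.1 (by omega))
  have hBv := (connected_induce_iff _).1 (hcut v hv)
  have hcl : G.IsClique (B.erase v : Set V) := by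
    -- For three vertices induction does not apply, as two-connected sets have more than two; the
    -- remaining pair is adjacent because it is connected.
    by_cases h2 : #B = 3
    · obtain ⟨x, y, hxy, he⟩ := card_eq_two.1 (show #(B.erase v) = 2 by
        rw [card_erase_of_mem hv]; omega)
      have he' : (B : Set V) \ {v} = {x, y} := by
        rw [← coe_erase, he]; simp
      rw [he'] at hBv
      obtain ⟨a, ha, b, ⟨hb, hba⟩, hab⟩ := hBv.2 {x} (by simp) (by simp) ⟨y, by simp [hxy.symm]⟩
      obtain rfl : a = x := ha
      obtain rfl : b = y := by
        rcases hb with rfl | hb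
        · exact absurd rfl hba
        · exact hb
      rw [he]
      simp [SimpleGraph.isClique_iff, Set.Pairwise, hab, hab.symm, hxy]
    · refine ih _ (erase_ssubset hv) ((erase_subset _ _).trans hBA) ⟨?_, ?_, ?_⟩
      · rw [Set.encard_coe_eq_coe_finsetCard, card_erase_of_mem hv]
        have : 2 < #B - 1 := by omega
        exact_mod_cast this
      · rw [coe_erase]
        exact hcut v hv
      · intro w hw
        rw [coe_erase] at hw ⊢
        have hwB := (connected_induce_iff _).1 (hcut w hw.1)
        rw [connected_induce_iff]
        have hvw : v ≠ w := fun h => hw.2 h.symm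
        refine ⟨?_, ?_⟩
        · have h1 : 1 < #(B.erase v) := by rw [card_erase_of_mem hv]; omega
          obtain ⟨z, hz, hzw⟩ := exists_mem_ne h1 w
          rw [mem_erase] at hz
          exact ⟨z, ⟨hz.2, hz.1⟩, hzw⟩
        · intro X hX hXne hXne'
          -- If `X` were separated from the rest after the deletion of `v` and `w`, then `v` would
          -- have a neighbour on either side, since `B \ {w}` is connected. These two are adjacent
          -- because `v` is simplicial.
          by_contra! hcon
          have hvX : v ∉ X := fun h => (hX h).1.2 rfl
          obtain ⟨x, hx, y, hy, hxy⟩ := hwB.2 X (fun z hz => ⟨(hX hz).1.1, (hX hz).2⟩) hXne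
            ⟨v, ⟨hv, hvw⟩, hvX⟩
          obtain rfl : y = v := by
            by_contra hyv
            exact hcon x hx y ⟨⟨⟨hy.1.1, hyv⟩, hy.1.2⟩, hy.2⟩ hxy
          obtain ⟨z, hz, y', hy', hzy⟩ := hwB.2 ((((B : Set V) \ {y}) \ {w}) \ X)
            (fun z hz => ⟨hz.1.1.1, hz.1.2⟩) hXne' ⟨y, ⟨hv, hvw⟩, fun h => h.1.1.2 rfl⟩
          by_cases hyX : y' ∈ X
          · exact hcon y' hyX z hz hzy.symm
          · obtain rfl : y' = y := by
              by_contra hyv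
              exact hy'.2 ⟨⟨⟨hy'.1.1, hyv⟩, hy'.1.2⟩, hyX⟩
            exact hcon x hx z hz (hs x (hX hx).1.1 z hz.1.1.1 hxy.symm hzy.symm
              fun h => hz.2 (h ▸ hx))
  obtain ⟨a, ha, x, hx, hvx⟩ := ((connected_induce_iff _).1 hconn).2 {v} (by simpa using hv)
    (by simp) (by
      obtain ⟨z, hz, hzv⟩ := exists_mem_ne (by omega : 1 < #B) v
      exact ⟨z, hz, hzv⟩)
  obtain rfl : a = v := ha
  obtain ⟨a', ha', y, hy, hvy⟩ := ((connected_induce_iff _).1 (hcut x hx.1)).2 {a}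
    (by rintro _ rfl; exact ⟨hv, fun h => hx.2 h.symm⟩)
    (by simp) (by
      have h1 : 1 < #(B.erase a) := by rw [card_erase_of_mem hv]; omega
      obtain ⟨z, hz, hzv⟩ := exists_mem_ne h1 x
      rw [mem_erase] at hz
      exact ⟨z, ⟨hz.2, hzv⟩, hz.1⟩)
  obtain rfl : a' = a := ha'
  -- The simplicial vertex has two neighbours `x` and `y` in `B`. Any further `z` closes a
  -- four-cycle with them, whose chord `Good` supplies.
  have hav : ∀ z ∈ B, z ≠ a' → G.Adj a' z := by
    intro z hz hza
    by_cases hzx : z = x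
    · exact hzx ▸ hvx
    by_cases hzy : z = y
    · exact hzy ▸ hvy
    have hmem : ∀ z ∈ B, z ≠ a' → z ∈ (B.erase a' : Set V) := fun z hz hza => by simp [hz, hza]
    exact hg a' (hBA hv) x (hBA hx.1) z (hBA hz) y (hBA hy.1.1) hvx
      (hcl (hmem x hx.1 hx.2) (hmem z hz hza) (Ne.symm hzx))
      (hcl (hmem z hz hza) (hmem y hy.1.1 hy.2) hzy) hvy.symm hza.symm (Ne.symm hy.1.2)
  intro z hz w hw hzw
  by_cases hza : z = a'
  · exact hza ▸ hav w hw fun h => hzw (hza.trans h.symm)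
  · by_cases hwa : w = a'
    · exact hwa ▸ (hav z hz hza).symm
    · exact hcl (by simpa [hza] using hz) (by simpa [hwa] using hw) hzw

theorem Simplicial.of_subset {X Y : Finset V} {v : V} (h : Simplicial G X v)
    (hN : ∀ y ∈ Y, G.Adj v y → y ∈ X) : Simplicial G Y v :=
  fun x hx y hy hvx hvy => h x (hN x hx hvx) y (hN y hy hvy) hvx hvy

/-- The prescribed exception `c` makes the induction work: a piece at a cut vertex must yield a
simplicial vertex other than the cut vertex, as that one has neighbours outside the piece. -/
theorem CliqueBlocks.exists_simplicial_ne [DecidableEq V] {A : Finset V} (h : CliqueBlocks G A)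
    (Y : Finset V) : Y ⊆ A → ∀ c, (∃ y ∈ Y, y ≠ c) → ∃ v ∈ Y, v ≠ c ∧ Simplicial G Y v := by
  classical
  induction Y using Finset.strongInduction with
  | H Y ih =>
  rintro hYA c ⟨u, hu, huc⟩
  by_cases hcl : G.IsClique (Y : Set V)
  · exact ⟨u, hu, huc, fun x hx y hy _ _ hxy => hcl hx hy hxy⟩
  obtain ⟨a, ha, b, hb, hab, hnab⟩ : ∃ a ∈ Y, ∃ b ∈ Y, a ≠ b ∧ ¬ G.Adj a b := by
    by_contra! hcon
    exact hcl fun x hx y hy hxy => hcon x hx y hy hxy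
  by_cases hconn : (G.induce (Y : Set V)).Connected
  · have h2 : 2 < #Y := by
      by_contra hle
      obtain ⟨x, hx, y, hy, hxy⟩ := ((connected_induce_iff _).1 hconn).2 {a} (by simpa using ha)
        (by simp) ⟨b, hb, hab.symm⟩
      obtain rfl : x = a := hx
      refine hle (two_lt_card.2 ⟨x, ha, b, hb, y, hy.1, hab, fun h => hy.2 h.symm, ?_⟩)
      rintro rfl
      exact hnab hxy
    have hn2 : ¬ IsTwoConnected G (Y : Set V) := fun h' => hcl (h Y hYA h')
    simp only [IsTwoConnected, Set.encard_coe_eq_coe_finsetCard, not_and, not_forall] at hn2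
    obtain ⟨w, hw, hnc⟩ := hn2 (by exact_mod_cast h2) hconn
    obtain ⟨z, hz, hzw⟩ := exists_mem_ne (by omega : 1 < #Y) w
    -- Induction applies to `X ∪ {w}` with the exception `w`; the vertex obtained lies in `X` and
    -- has no neighbours in `Y` outside `X ∪ {w}`. One of the two sides avoids `c`.
    have side : ∀ X : Set V, X ⊆ (Y : Set V) \ {w} → X.Nonempty →
        (((Y : Set V) \ {w}) \ X).Nonempty →
        (∀ x ∈ X, ∀ y ∈ ((Y : Set V) \ {w}) \ X, ¬ G.Adj x y) → c ∉ X →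
        ∃ v ∈ Y, v ≠ c ∧ Simplicial G Y v := by
      rintro X hX ⟨x, hx⟩ ⟨y, hy⟩ hcross hcX
      obtain ⟨v, hv, hvw, hvs⟩ := ih (insert w (Y.filter (· ∈ X)))
        ⟨by
          rw [insert_subset_iff]
          exact ⟨hw, filter_subset _ _⟩, fun hsub => by
          have := hsub hy.1.1
          rw [mem_insert, mem_filter] at this
          rcases this with h | h
          · exact hy.1.2 h
          · exact hy.2 h.2⟩
        (by
          rw [insert_subset_iff]
          exact ⟨hYA hw, (filter_subset _ _).trans hYA⟩) w
        ⟨x, mem_insert_of_mem (mem_filter.2 ⟨(hX hx).1, hx⟩), (hX hx).2⟩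
      have hvX : v ∈ X := (mem_filter.1 ((mem_insert.1 hv).resolve_left hvw)).2
      refine ⟨v, (hX hvX).1, fun h => hcX (h ▸ hvX), hvs.of_subset fun t ht hvt => ?_⟩
      rw [mem_insert, mem_filter]
      by_contra! hcon
      exact hcross v hvX t ⟨⟨ht, hcon.1⟩, hcon.2 ht⟩ hvt
    obtain ⟨X, hX, hne, hne', hcross⟩ := not_connected_induce
      (⟨z, hz, hzw⟩ : ((Y : Set V) \ {w}).Nonempty) hnc
    by_cases hcX : c ∈ X
    · refine side (((Y : Set V) \ {w}) \ X) Set.sdiff_subset hne' ?_ ?_ fun h => h.2 hcX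
      · rwa [Set.sdiff_sdiff_cancel_left hX]
      · rw [Set.sdiff_sdiff_cancel_left hX]
        exact fun x hx y hy hxy => hcross y hy x hx hxy.symm
    · exact side X hX hne hne' hcross hcX
  · have side : ∀ X : Set V, X ⊆ (Y : Set V) → X.Nonempty → ((Y : Set V) \ X).Nonempty →
        (∀ x ∈ X, ∀ y ∈ (Y : Set V) \ X, ¬ G.Adj x y) → c ∉ X →
        ∃ v ∈ Y, v ≠ c ∧ Simplicial G Y v := by
      rintro X hX ⟨x, hx⟩ ⟨y, hy⟩ hcross hcX
      have hv : ∃ v ∈ Y.filter (· ∈ X), Simplicial G (Y.filter (· ∈ X)) v := by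
        by_cases hx' : ∃ y ∈ Y.filter (· ∈ X), y ≠ x
        · obtain ⟨v, hv, -, hvs⟩ := ih (Y.filter (· ∈ X)) ⟨filter_subset _ _, fun hsub =>
            hy.2 (mem_filter.1 (hsub hy.1)).2⟩ ((filter_subset _ _).trans hYA) x hx'
          exact ⟨v, hv, hvs⟩
        · push Not at hx'
          exact ⟨x, mem_filter.2 ⟨hX hx, hx⟩, fun p hp q hq _ _ hpq =>
            absurd ((hx' p hp).trans (hx' q hq).symm) hpq⟩
      obtain ⟨v, hv, hvs⟩ := hv
      have hvX := (mem_filter.1 hv).2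
      refine ⟨v, hX hvX, fun h => hcX (h ▸ hvX), hvs.of_subset fun t ht hvt => ?_⟩
      rw [mem_filter]
      by_contra! hcon
      exact hcross v hvX t ⟨ht, hcon ht⟩ hvt
    obtain ⟨X, hX, hne, hne', hcross⟩ := not_connected_induce ⟨u, hu⟩ hconn
    by_cases hcX : c ∈ X
    · refine side ((Y : Set V) \ X) Set.sdiff_subset hne' ?_ ?_ fun h => h.2 hcX
      · rwa [Set.sdiff_sdiff_cancel_left hX]
      · rw [Set.sdiff_sdiff_cancel_left hX]
        exact fun x hx y hy hxy => hcross y hy x hx hxy.symm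
    · exact side X hX hne hne' hcross hcX

theorem CliqueBlocks.dismantlable [DecidableEq V] {A : Finset V} (h : CliqueBlocks G A) :
    Dismantlable G A := by
  rintro Y hY ⟨c, hc⟩
  by_cases hex : ∃ y ∈ Y, y ≠ c
  · obtain ⟨v, hv, -, hs⟩ := h.exists_simplicial_ne Y hY c hex
    exact ⟨v, hv, hs⟩
  · push Not at hex
    exact ⟨c, hc, fun p hp q hq _ _ hpq => absurd ((hex p hp).trans (hex q hq).symm) hpq⟩

/-- The vertex set of a four-cycle is two-connected: each deletion leaves a path. -/
theorem CliqueBlocks.good [DecidableEq V] {A : Finset V} (h : CliqueBlocks G A) : Good G A := by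
  intro a ha b hb c hc d hd hab hbc hcd hda hac hbd
  have path : ∀ x y z, G.Adj x y → G.Adj y z → (G.induce ({x, y, z} : Set V)).Connected := by
    intro x y z hxy hyz
    have := SimpleGraph.induce_union_connected (SimpleGraph.induce_pair_connected_of_adj hxy).preconnected
      (SimpleGraph.induce_pair_connected_of_adj hyz).preconnected ⟨y, by simp⟩
    convert this using 2 <;> (ext; simp; try tauto)
  have hcl := h {a, b, c, d} (by simp [insert_subset_iff, ha, hb, hc, hd]) ⟨?_, ?_, ?_⟩
  · exact hcl (by simp) (by simp) hac
  · rw [Set.encard_coe_eq_coe_finsetCard]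
    have : 2 < #({a, b, c, d} : Finset V) :=
      two_lt_card.2 ⟨a, by simp, b, by simp, c, by simp, hab.ne, hac, hbc.ne⟩
    exact_mod_cast this
  · have := SimpleGraph.induce_union_connected (path a b c hab hbc).preconnected
      (path c d a hcd hda).preconnected
      ⟨a, by simp⟩
    convert this using 2 <;> (ext; simp; try tauto)
  · intro v hv
    have key : ∀ x y z, G.Adj x y → G.Adj y z → ((({a, b, c, d} : Finset V) : Set V) \ {v}) =
        {x, y, z} → (G.induce ((({a, b, c, d} : Finset V) : Set V) \ {v})).Connected := by
      intro x y z hxy hyz he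
      rw [he]
      exact path x y z hxy hyz
    have h1 := hab.ne
    have h2 := hbc.ne
    have h3 := hcd.ne
    have h4 := hda.ne
    simp only [coe_insert, coe_singleton, Set.mem_insert_iff, Set.mem_singleton_iff] at hv
    rcases hv with rfl | rfl | rfl | rfl
    · exact key b c d hbc hcd (by ext; simp; grind)
    · exact key c d a hcd hda (by ext; simp; grind)
    · exact key d a b hda hab (by ext; simp; grind)
    · exact key a b c hab hbc (by ext; simp; grind)

theorem connected_induce_induce (S : Set V) (B : Set S) :
    ((G.induce S).induce B).Connected ↔ (G.induce (Subtype.val '' B)).Connected := by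
  refine SimpleGraph.Iso.connected_iff
    ⟨Equiv.Set.image Subtype.val B Subtype.val_injective, ?_⟩
  rintro ⟨x, hx⟩ ⟨y, hy⟩
  exact Iff.rfl

theorem isTwoConnected_induce (S : Set V) (B : Set S) :
    IsTwoConnected (G.induce S) B ↔ IsTwoConnected G (Subtype.val '' B) := by
  unfold IsTwoConnected
  rw [Subtype.val_injective.encard_image, connected_induce_induce]
  refine and_congr_right fun _ => and_congr_right fun _ => ?_
  rw [Set.forall_mem_image]
  refine forall₂_congr fun v hv => ?_
  rw [connected_induce_induce, Set.image_sdiff Subtype.val_injective, Set.image_singleton]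

/-- By finiteness each two-connected set lies in a maximal one, so maximality can be dropped. -/
theorem isBlockGraph_induce_iff [Finite V] (A : Finset V) :
    IsBlockGraph (G.induce (A : Set V)) ↔ CliqueBlocks G A := by
  constructor
  · intro h B hB h2
    have himg : Subtype.val '' (Subtype.val ⁻¹' (B : Set V) : Set (A : Set V)) = B := by
      rw [Subtype.image_preimage_coe]
      exact Set.inter_eq_right.2 (by exact_mod_cast hB)
    obtain ⟨M, hM, hmax⟩ := (Set.toFinite {B | IsTwoConnected (G.induce (A : Set V)) B}).exists_le_maximal
      (a := Subtype.val ⁻¹' (B : Set V)) ((isTwoConnected_induce _ _).2 (himg.symm ▸ h2))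
    have hc := h M hmax
    intro x hx y hy hxy
    exact hc (x := ⟨x, hB hx⟩) (hM hx) (y := ⟨y, hB hy⟩) (hM hy)
      fun h => hxy (congrArg Subtype.val h)
  · intro h B hB x hx y hy hxy
    have hfin := Set.toFinite (Subtype.val '' B)
    have := h hfin.toFinset (fun z hz => by
      obtain ⟨w, _, rfl⟩ := hfin.mem_toFinset.1 hz
      exact w.2) (by
      rw [hfin.coe_toFinset]
      exact (isTwoConnected_induce _ _).1 hB.prop)
    rw [hfin.coe_toFinset] at this
    exact this ⟨x, hx, rfl⟩ ⟨y, hy, rfl⟩ fun h => hxy (Subtype.ext h)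

/-! The hypergraph of the maximal cliques. -/

variable [DecidableEq V] [DecidableRel G.Adj]

variable (G) in
/-- The vertices of `A` in the closed neighbourhoods of `u` and `v`: the maximal clique through an
edge `uv` if `A` has no induced diamond. -/
def cliqueThrough (A : Finset V) (u v : V) : Finset V :=
  {x ∈ A | (x = u ∨ G.Adj u x) ∧ (x = v ∨ G.Adj v x)}

variable (G) in
/-- The maximal cliques with more than one vertex. -/
def maxCliques (A : Finset V) : Finset (Finset V) :=
  ((A ×ˢ A).filter fun p => G.Adj p.1 p.2).image fun p => cliqueThrough G A p.1 p.2

variable (G) in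
/-- The number of maximal cliques through `v`, computed as the number of first vertices of the
cliques in the neighbourhood of `v`. -/
def cliqueDegree [LinearOrder V] (A : Finset V) (v : V) : ℕ :=
  #{u ∈ A | G.Adj v u ∧ ∀ w ∈ A, w < u → G.Adj v w → ¬ G.Adj w u}

theorem cliqueThrough_mem {A : Finset V} {u v : V} (hu : u ∈ A) (hv : v ∈ A) (h : G.Adj u v) :
    cliqueThrough G A u v ∈ maxCliques G A :=
  mem_image.2 ⟨(u, v), mem_filter.2 ⟨mem_product.2 ⟨hu, hv⟩, h⟩, rfl⟩

theorem left_mem_cliqueThrough {A : Finset V} {u v : V} (hu : u ∈ A) (h : G.Adj u v) :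
    u ∈ cliqueThrough G A u v := mem_filter.2 ⟨hu, .inl rfl, .inr h.symm⟩

theorem right_mem_cliqueThrough {A : Finset V} {u v : V} (hv : v ∈ A) (h : G.Adj u v) :
    v ∈ cliqueThrough G A u v := mem_filter.2 ⟨hv, .inr h, .inl rfl⟩

/-- Two common neighbours `x`, `y` of the ends of an edge `uv` form the four-cycle `x u y v`, and
`Good` gives its chord `xy`. -/
theorem Good.adj_of_mem {A : Finset V} (hg : Good G A) {k : Finset V} (hk : k ∈ maxCliques G A)
    {x y : V} (hx : x ∈ k) (hy : y ∈ k) (hxy : x ≠ y) : G.Adj x y := by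
  obtain ⟨⟨u, v⟩, huv, rfl⟩ := mem_image.1 hk
  obtain ⟨hA, huv⟩ := mem_filter.1 huv
  obtain ⟨hu, hv⟩ := mem_product.1 hA
  obtain ⟨hxA, hxu, hxv⟩ := mem_filter.1 hx
  obtain ⟨hyA, hyu, hyv⟩ := mem_filter.1 hy
  dsimp only at *
  rcases hxu with rfl | hxu
  · exact hyu.resolve_left (Ne.symm hxy)
  rcases hxv with rfl | hxv
  · exact hyv.resolve_left (Ne.symm hxy)
  rcases hyu with rfl | hyu
  · exact hxu.symm
  rcases hyv with rfl | hyv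
  · exact hxv.symm
  exact hg x hxA u hu y hyA v hv hxu.symm hyu hyv.symm hxv hxy huv.ne

theorem maxCliques_subset {A k : Finset V} (hk : k ∈ maxCliques G A) : k ⊆ A := by
  obtain ⟨⟨u, v⟩, huv, rfl⟩ := mem_image.1 hk
  exact filter_subset _ _

/-- In other words, two maximal cliques share at most one vertex. Any of them through `x` and `y`
lies in `cliqueThrough G A x y`; the reverse inclusion is the same fact for the edge that defines
`k`. -/
theorem Good.eq_cliqueThrough {A : Finset V} (hg : Good G A) {k : Finset V}
    (hk : k ∈ maxCliques G A) {x y : V} (hx : x ∈ k) (hy : y ∈ k) (hxy : x ≠ y) :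
    k = cliqueThrough G A x y := by
  have sub : ∀ l ∈ maxCliques G A, ∀ a ∈ l, ∀ b ∈ l, l ⊆ cliqueThrough G A a b := by
    intro l hl a ha b hb z hz
    refine mem_filter.2 ⟨maxCliques_subset hl hz, ?_, ?_⟩
    · exact or_iff_not_imp_left.2 fun h => hg.adj_of_mem hl ha hz (Ne.symm h)
    · exact or_iff_not_imp_left.2 fun h => hg.adj_of_mem hl hb hz (Ne.symm h)
  refine (sub k hk x hx y hy).antisymm ?_
  have h2 := cliqueThrough_mem (maxCliques_subset hk hx) (maxCliques_subset hk hy)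
    (hg.adj_of_mem hk hx hy hxy)
  obtain ⟨⟨u, v⟩, huv, rfl⟩ := mem_image.1 hk
  obtain ⟨hA, huv⟩ := mem_filter.1 huv
  obtain ⟨hu, hv⟩ := mem_product.1 hA
  have h3 := sub _ hk x hx y hy
  exact sub _ h2 u (h3 (left_mem_cliqueThrough hu huv)) v (h3 (right_mem_cliqueThrough hv huv))

/-- Two neighbours of `v` are adjacent iff they span the same maximal clique with `v`. The cliques
are those of `A`, so the hypergraph stays fixed while vertices are deleted. -/
theorem Good.simplicial_iff {A Y : Finset V} (hg : Good G A) (hY : Y ⊆ A) {v : V} (hv : v ∈ Y) :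
    Simplicial G Y v ↔ #{k ∈ maxCliques G A | v ∈ k ∧ ∃ y ∈ Y, y ≠ v ∧ y ∈ k} ≤ 1 := by
  constructor
  · intro h
    refine card_le_one.2 fun k hk k' hk' => ?_
    obtain ⟨hk, hvk, y, hy, hyv, hyk⟩ := mem_filter.1 hk
    obtain ⟨hk', hvk', y', hy', hyv', hyk'⟩ := mem_filter.1 hk'
    rw [hg.eq_cliqueThrough hk hvk hyk (Ne.symm hyv)]
    have hvy := hg.adj_of_mem hk hvk hyk (Ne.symm hyv)
    have hvy' := hg.adj_of_mem hk' hvk' hyk' (Ne.symm hyv')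
    rw [hg.eq_cliqueThrough hk' hvk' hyk' (Ne.symm hyv')]
    refine hg.eq_cliqueThrough (cliqueThrough_mem (hY hv) (hY hy) hvy)
      (left_mem_cliqueThrough (hY hv) hvy) (mem_filter.2 ⟨hY hy', .inr hvy', ?_⟩) (Ne.symm hyv')
    exact or_iff_not_imp_left.2 fun hne => h y hy y' hy' hvy hvy' (Ne.symm hne)
  · intro h x hx y hy hvx hvy hxy
    have he := card_le_one.1 h _ (mem_filter.2 ⟨cliqueThrough_mem (hY hv) (hY hx) hvx,
      left_mem_cliqueThrough (hY hv) hvx, x, hx, hvx.ne', right_mem_cliqueThrough (hY hx) hvx⟩) _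
      (mem_filter.2 ⟨cliqueThrough_mem (hY hv) (hY hy) hvy,
      left_mem_cliqueThrough (hY hv) hvy, y, hy, hvy.ne', right_mem_cliqueThrough (hY hy) hvy⟩)
    have hyk := right_mem_cliqueThrough (hY hy) hvy
    rw [← he] at hyk
    exact (mem_filter.1 hyk).2.2.resolve_left (Ne.symm hxy)

theorem Good.elim_iff {A X : Finset V} (hg : Good G A) (hX : X ⊆ A) :
    Elim (fun v k => v ∈ k) (maxCliques G A) X ↔ Dismantlable G X := by
  refine forall₃_congr fun Y hY _ => exists_congr fun v => and_congr_right fun hv => ?_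
  exact (hg.simplicial_iff (hY.trans hX) hv).symm

/-- The cliques through `v` are disjoint outside `v`, so each is determined by its least vertex
other than `v`. -/
theorem Good.deg_eq [LinearOrder V] {A : Finset V} (hg : Good G A) {v : V} (hv : v ∈ A) :
    deg (fun v k => v ∈ k) (maxCliques G A) v = cliqueDegree G A v := by
  symm
  refine card_bij (fun u _ => cliqueThrough G A v u) ?_ ?_ ?_
  · intro u hu
    obtain ⟨hu, hvu, -⟩ := mem_filter.1 hu
    exact mem_filter.2 ⟨cliqueThrough_mem hv hu hvu, left_mem_cliqueThrough hv hvu⟩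
  · intro u hu u' hu' he
    obtain ⟨hu, hvu, hmin⟩ := mem_filter.1 hu
    obtain ⟨hu', hvu', hmin'⟩ := mem_filter.1 hu'
    by_contra hne
    have h1 := right_mem_cliqueThrough hu hvu
    rw [he] at h1
    have hadj := (mem_filter.1 h1).2.2.resolve_left hne
    rcases lt_or_gt_of_ne hne with h | h
    · exact hmin' u hu h hvu hadj.symm
    · exact hmin u' hu' h hvu' hadj
  · intro k hk
    obtain ⟨hk, hvk⟩ := mem_filter.1 hk
    have hne : (k.erase v).Nonempty := by
      obtain ⟨⟨a, b⟩, hab, rfl⟩ := mem_image.1 hk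
      obtain ⟨hA, hab⟩ := mem_filter.1 hab
      obtain ⟨ha, hb⟩ := mem_product.1 hA
      by_cases hav : a = v
      · exact ⟨b, mem_erase.2 ⟨fun h => hab.ne (hav.trans h.symm), right_mem_cliqueThrough hb hab⟩⟩
      · exact ⟨a, mem_erase.2 ⟨hav, left_mem_cliqueThrough ha hab⟩⟩
    have hmem := (k.erase v).min'_mem hne
    set u := (k.erase v).min' hne with hu
    obtain ⟨huv, huk⟩ := mem_erase.1 hmem
    have hk' := hg.eq_cliqueThrough hk hvk huk (Ne.symm huv)
    refine ⟨u, mem_filter.2 ⟨maxCliques_subset hk huk, hg.adj_of_mem hk hvk huk (Ne.symm huv),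
      fun w hw hwu hvw hwadj => ?_⟩, hk'.symm⟩
    have hwk : w ∈ k := by
      rw [hk']
      exact mem_filter.2 ⟨hw, .inr hvw, .inr hwadj.symm⟩
    exact absurd ((k.erase v).min'_le w (mem_erase.2 ⟨hvw.ne', hwk⟩)) (not_le.2 hwu)

theorem Good.two_le_cliqueDegree [LinearOrder V] {A : Finset V} (hg : Good G A) {v : V}
    (hv : v ∈ A) (hs : ¬ Simplicial G A v) : 2 ≤ cliqueDegree G A v := by
  rw [← hg.deg_eq hv]
  rw [hg.simplicial_iff Subset.rfl hv, not_le] at hs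
  exact le_trans hs (card_le_card (monotone_filter_right _ fun k _ hk => hk.1))

theorem Good.sum_cliqueDegree_le [LinearOrder V] {A F F' : Finset V} (hg : Good G A)
    (hA : ∀ v ∈ A, ¬ Simplicial G A v) (hF : F ⊆ A) (hE : Dismantlable G (A \ F))
    (hmin : ∀ v ∈ F, ¬ Dismantlable G (insert v (A \ F))) (hF' : F' ⊆ A)
    (hE' : Dismantlable G (A \ F')) :
    ∑ v ∈ F, (cliqueDegree G A v - 1) ≤ 4 * ∑ v ∈ F', (cliqueDegree G A v - 1) := by
  have h := sum_deg_le (I := fun v k => v ∈ k) (L := maxCliques G A) (A := A) (F := F) (F' := F')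
    (fun v hv => by
      rw [hg.deg_eq hv]
      exact hg.two_le_cliqueDegree hv (hA v hv))
    (fun k hk => by
      obtain ⟨⟨a, b⟩, hab, rfl⟩ := mem_image.1 hk
      obtain ⟨hAA, hab⟩ := mem_filter.1 hab
      obtain ⟨ha, hb⟩ := mem_product.1 hAA
      exact one_lt_card.2 ⟨a, mem_filter.2 ⟨ha, left_mem_cliqueThrough ha hab⟩, b,
        mem_filter.2 ⟨hb, right_mem_cliqueThrough hb hab⟩, hab.ne⟩)
    hF ((hg.elim_iff sdiff_subset).2 hE)
    (fun v hv h => hmin v hv ((hg.elim_iff (insert_subset (hF hv) sdiff_subset)).1 h))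
    hF' ((hg.elim_iff sdiff_subset).2 hE')
  rwa [sum_congr rfl fun v hv => by rw [hg.deg_eq (hF hv)],
    sum_congr rfl fun v (hv : v ∈ F') => by rw [hg.deg_eq (hF' hv)]] at h

end BlockGraphs

/-! ### The local ratio algorithm with reverse deletion. -/

section LocalRatio

open Finset

set_option linter.unusedSectionVars false

variable {V : Type*} [Fintype V] [LinearOrder V] (G : SimpleGraph V) [DecidableRel G.Adj]

instance (Y : Finset V) (v : V) : Decidable (Simplicial G Y v) := by
  unfold Simplicial
  infer_instance

/-- Delete all simplicial vertices. -/
def peel (A : Finset V) : Finset V := {v ∈ A | ¬ Simplicial G A v}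

/-- The largest subset of `A` without simplicial vertices. -/
def core (A : Finset V) : Finset V := (peel G)^[Fintype.card V] A

/-- The vertex `v` minimizes `w v / (cliqueDegree v - 1)`. -/
def IsRatioMin (A : Finset V) (w : V → ℕ) (v : V) : Prop :=
  v ∈ A ∧ ∀ x ∈ A, w v * (cliqueDegree G A x - 1) ≤ w x * (cliqueDegree G A v - 1)

instance (A : Finset V) (w : V → ℕ) (v : V) : Decidable (IsRatioMin G A w v) := by
  unfold IsRatioMin
  infer_instance

/-- The first vertex of minimum ratio. -/
def pick (A : Finset V) (w : V → ℕ) : Finset V :=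
  {v | IsRatioMin G A w v ∧ ∀ x < v, ¬ IsRatioMin G A w x}

/-- One step of the local ratio algorithm; the weights are scaled to avoid division. -/
def ratioStep (s : Finset V × (V → ℕ)) : Finset V × (V → ℕ) :=
  (core G (s.1 \ pick G s.1 s.2), fun v => ∑ u ∈ pick G s.1 s.2,
    (s.2 v * (cliqueDegree G s.1 u - 1) - s.2 u * (cliqueDegree G s.1 v - 1)))

/-- The local ratio algorithm with reverse deletion. -/
def solve : ℕ → Finset V × (V → ℕ) → Finset V
  | 0, _ => ∅
  | m + 1, s =>
    if core G (s.1 \ solve m (ratioStep G s)) = ∅ then solve m (ratioStep G s)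
    else solve m (ratioStep G s) ∪ pick G s.1 s.2

variable {G}

theorem peel_subset (A : Finset V) : peel G A ⊆ A := filter_subset _ _

theorem iterate_peel_subset (A : Finset V) (m : ℕ) : (peel G)^[m] A ⊆ A := by
  induction m with
  | zero => exact Subset.rfl
  | succ m ih =>
    rw [Function.iterate_succ_apply']
    exact (peel_subset _).trans ih

theorem core_subset (A : Finset V) : core G A ⊆ A := iterate_peel_subset A _

/-- Every round that is not stationary removes a vertex, so `Fintype.card V` rounds suffice. -/
theorem peel_core (A : Finset V) : peel G (core G A) = core G A := by
  have key : ∀ m, peel G ((peel G)^[m] A) = (peel G)^[m] A ∨ #((peel G)^[m] A) + m ≤ #A := by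
    intro m
    induction m with
    | zero => exact .inr le_rfl
    | succ m ih =>
      rw [Function.iterate_succ_apply']
      by_cases h : peel G ((peel G)^[m] A) = (peel G)^[m] A
      · exact .inl (by rw [h, h])
      · have h1 := ih.resolve_left h
        have h2 := card_lt_card ((peel_subset ((peel G)^[m] A)).ssubset_of_ne h)
        exact .inr (by omega)
  rcases key (Fintype.card V) with h | h
  · exact h
  · have h1 := card_le_univ A
    have h2 : core G A = ∅ := card_eq_zero.1 (by unfold core; omega)
    rw [h2]
    rfl

theorem not_simplicial_of_mem_core {A : Finset V} {v : V} (hv : v ∈ core G A) :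
    ¬ Simplicial G (core G A) v := by
  rw [← peel_core] at hv
  exact (mem_filter.1 hv).2

/-- A vertex of `Y` that is simplicial in a larger set is simplicial in `Y`, so no round removes a
vertex of `Y`. -/
theorem subset_core {A Y : Finset V} (hY : Y ⊆ A) (h : ∀ v ∈ Y, ¬ Simplicial G Y v) :
    Y ⊆ core G A := by
  have key : ∀ m, Y ⊆ (peel G)^[m] A := by
    intro m
    induction m with
    | zero => exact hY
    | succ m ih =>
      rw [Function.iterate_succ_apply']
      refine fun v hv => mem_filter.2 ⟨ih hv, fun hs => h v hv ?_⟩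
      exact fun x hx y hy => hs x (ih hx) y (ih hy)
  exact key _

theorem dismantlable_of_core_subset {A B : Finset V} (h : Dismantlable G B) (hA : core G A ⊆ B) :
    Dismantlable G A := by
  intro Y hY hne
  by_contra! hcon
  obtain ⟨v, hv, hs⟩ := h Y ((subset_core hY hcon).trans hA) hne
  exact hcon v hv hs

theorem core_eq_empty_iff {A : Finset V} : core G A = ∅ ↔ Dismantlable G A := by
  constructor
  · intro h
    refine dismantlable_of_core_subset (B := ∅) (fun Y hY hne => ?_) h.subset
    exact absurd (subset_empty.1 hY) hne.ne_empty
  · intro h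
    by_contra hne
    obtain ⟨v, hv, hs⟩ := h _ (core_subset A) (nonempty_iff_ne_empty.2 hne)
    exact not_simplicial_of_mem_core hv hs

theorem dismantlable_core_sdiff {A F : Finset V} (h : Dismantlable G (core G A \ F)) :
    Dismantlable G (A \ F) := by
  refine dismantlable_of_core_subset h fun v hv => mem_sdiff.2 ⟨?_, (mem_sdiff.1 (core_subset _ hv)).2⟩
  exact subset_core ((core_subset _).trans sdiff_subset) (fun _ => not_simplicial_of_mem_core) hv

theorem exists_pick_eq {A : Finset V} (w : V → ℕ) (hA : A.Nonempty)
    (hd : ∀ v ∈ A, 2 ≤ cliqueDegree G A v) : ∃ u, IsRatioMin G A w u ∧ pick G A w = {u} := by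
  have hne : ({v | IsRatioMin G A w v} : Finset V).Nonempty := by
    obtain ⟨u, hu, hmin⟩ := exists_min_image A
      (fun v => (w v : ℚ) / ((cliqueDegree G A v - 1 : ℕ) : ℚ)) hA
    refine ⟨u, mem_filter.2 ⟨mem_univ _, hu, fun x hx => ?_⟩⟩
    have h1 := hmin x hx
    have h2 := hd x hx
    have h3 := hd u hu
    rw [div_le_div_iff₀ (by exact_mod_cast (by omega)) (by exact_mod_cast (by omega))] at h1
    exact_mod_cast h1
  have hmem := min'_mem _ hne
  refine ⟨_, (mem_filter.1 hmem).2, ?_⟩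
  ext v
  simp only [pick, mem_filter, mem_univ, true_and, mem_singleton]
  constructor
  · rintro ⟨h1, h2⟩
    refine le_antisymm ?_ (min'_le _ _ (mem_filter.2 ⟨mem_univ _, h1⟩))
    by_contra hlt
    exact h2 _ (not_le.1 hlt) (mem_filter.1 hmem).2
  · rintro rfl
    refine ⟨(mem_filter.1 hmem).2, fun x hx hr => ?_⟩
    exact absurd (min'_le _ _ (mem_filter.2 ⟨mem_univ _, hr⟩)) (not_le.2 hx)

/-- The field `minimal` is carried through the induction because `Good.sum_cliqueDegree_le` requires
it. -/
structure IsSolution (G : SimpleGraph V) (A : Finset V) (w : V → ℕ) (F : Finset V) : Prop where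
  subset : F ⊆ A
  dismantlable : Dismantlable G (A \ F)
  minimal : ∀ v ∈ F, ¬ Dismantlable G (insert v (A \ F))
  le : ∀ F' ⊆ A, Dismantlable G (A \ F') → ∑ v ∈ F, w v ≤ 4 * ∑ v ∈ F', w v

theorem dismantlable_empty : Dismantlable G ∅ := fun _ hY hne =>
  absurd (subset_empty.1 hY) hne.ne_empty

theorem isSolution_empty (w : V → ℕ) : IsSolution G ∅ w ∅ :=
  ⟨Subset.rfl, by simpa using dismantlable_empty, by simp, by simp⟩

/-- Up to the factor `deg u - 1`, the weights are the new weights plus a multiple of `deg - 1`. The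
set is within factor four for the former by induction, for the latter by `Good.sum_cliqueDegree_le`,
hence for the sum. -/
theorem isSolution_solve (m : ℕ) (A : Finset V) (w : V → ℕ) (hg : Good G A)
    (hA : ∀ v ∈ A, ¬ Simplicial G A v) (hm : #A ≤ m) : IsSolution G A w (solve G m (A, w)) := by
  induction m generalizing A w with
  | zero =>
    obtain rfl := card_eq_zero.1 (Nat.le_zero.1 hm)
    exact isSolution_empty w
  | succ m ih =>
  have hsub : (ratioStep G (A, w)).1 ⊆ A := (core_subset _).trans sdiff_subset
  -- Once the set is empty nothing is picked and the remaining rounds are idle, so a fixed number of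
  -- rounds is harmless.
  rcases A.eq_empty_or_nonempty with rfl | hne
  · have h0 : (ratioStep G (∅, w)).1 = ∅ := subset_empty.1 hsub
    have hsol := ih (ratioStep G (∅, w)).1 (ratioStep G (∅, w)).2 (hg.mono hsub)
      (by simp [h0]) (by simp [h0])
    have h1 : solve G m (ratioStep G (∅, w)) = ∅ := subset_empty.1 (hsol.subset.trans h0.subset)
    have h2 : solve G (m + 1) (∅, w) = ∅ := by
      simp only [solve, h1]
      rw [if_pos (subset_empty.1 ((core_subset _).trans sdiff_subset))]
    rw [h2]
    exact isSolution_empty w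
  have hd : ∀ v ∈ A, 2 ≤ cliqueDegree G A v := fun v hv => hg.two_le_cliqueDegree hv (hA v hv)
  obtain ⟨u, ⟨huA, humin⟩, hpick⟩ := exists_pick_eq w hne hd
  have hB : (ratioStep G (A, w)).1 = core G (A.erase u) := by
    simp [ratioStep, hpick, sdiff_singleton_eq_erase]
  have hwt : (ratioStep G (A, w)).2 = fun v =>
      w v * (cliqueDegree G A u - 1) - w u * (cliqueDegree G A v - 1) := by
    simp [ratioStep, hpick]
  have hBA : core G (A.erase u) ⊆ A.erase u := core_subset _
  have hsol : IsSolution G (ratioStep G (A, w)).1 (ratioStep G (A, w)).2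
      (solve G m (ratioStep G (A, w))) := ih _ _ (hg.mono hsub) (by rw [hB]; exact fun v => not_simplicial_of_mem_core) (by
      rw [hB]
      have := card_le_card hBA
      rw [card_erase_of_mem huA] at this
      omega)
  have hsolve : solve G (m + 1) (A, w) =
      if core G (A \ solve G m (ratioStep G (A, w))) = ∅ then solve G m (ratioStep G (A, w))
      else solve G m (ratioStep G (A, w)) ∪ {u} := by
    rw [← hpick]
    rfl
  rw [hsolve]
  generalize solve G m (ratioStep G (A, w)) = F at hsol ⊢
  rw [hB, hwt] at hsol
  have hFA : F ⊆ A := hsol.subset.trans (hBA.trans (erase_subset _ _))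
  have huF : u ∉ F := fun h => (mem_erase.1 (hBA (hsol.subset h))).1 rfl
  -- all but the comparison of the weights
  obtain ⟨S, hS, hSA, hSE, hSmin, hFS, hSF⟩ : ∃ S, (if core G (A \ F) = ∅ then F else F ∪ {u}) = S ∧
      S ⊆ A ∧ Dismantlable G (A \ S) ∧ (∀ v ∈ S, ¬ Dismantlable G (insert v (A \ S))) ∧
      F ⊆ S ∧ S ⊆ insert u F := by
    refine ⟨_, rfl, ?_⟩
    split_ifs with hcore
    · refine ⟨hFA, core_eq_empty_iff.1 hcore, fun v hv hdis => hsol.minimal v hv (hdis.mono ?_),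
        Subset.rfl, subset_insert _ _⟩
      exact insert_subset_insert _ (sdiff_subset_sdiff (hBA.trans (erase_subset _ _)) Subset.rfl)
    · refine ⟨union_subset hFA (by simpa using huA), ?_, fun v hv hdis => ?_, subset_union_left,
        by rw [union_comm]; rfl⟩
      · have h1 := dismantlable_core_sdiff hsol.dismantlable
        refine h1.mono fun x hx => ?_
        simp only [mem_sdiff, mem_union, mem_singleton, mem_erase] at hx ⊢
        tauto
      · rcases mem_union.1 hv with hv | hv
        · refine hsol.minimal v hv (hdis.mono (insert_subset_insert _ fun x hx => ?_))
          have := mem_erase.1 (hBA (mem_sdiff.1 hx).1)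
          simp only [mem_sdiff, mem_union, mem_singleton] at hx ⊢
          tauto
        · obtain rfl := mem_singleton.1 hv
          refine hcore (core_eq_empty_iff.2 (hdis.mono fun x hx => ?_))
          simp only [mem_insert, mem_sdiff, mem_union, mem_singleton] at hx ⊢
          tauto
  rw [hS]
  refine ⟨hSA, hSE, hSmin, fun F' hF' hE' => ?_⟩
  have hpos : 0 < cliqueDegree G A u - 1 := by have := hd u huA; omega
  -- On `A` no subtraction truncates, since `u` has the minimum ratio.
  have hdecomp : ∀ T ⊆ A, (∑ v ∈ T, w v) * (cliqueDegree G A u - 1) =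
      ∑ v ∈ T, (w v * (cliqueDegree G A u - 1) - w u * (cliqueDegree G A v - 1)) +
        w u * ∑ v ∈ T, (cliqueDegree G A v - 1) := by
    intro T hT
    rw [sum_mul, mul_sum, ← sum_add_distrib]
    exact sum_congr rfl fun v hv => (Nat.sub_add_cancel (humin v (hT hv))).symm
  refine Nat.le_of_mul_le_mul_right ?_ hpos
  rw [mul_assoc, hdecomp S hSA, hdecomp F' hF', mul_add]
  refine add_le_add ?_ ?_
  -- `S` and `F` differ at most in `u`, whose new weight is zero.
  · have h1 : ∑ v ∈ S, (w v * (cliqueDegree G A u - 1) - w u * (cliqueDegree G A v - 1)) =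
        ∑ v ∈ F, (w v * (cliqueDegree G A u - 1) - w u * (cliqueDegree G A v - 1)) := by
      symm
      refine sum_subset hFS fun x hx hxF => ?_
      obtain rfl := (mem_insert.1 (hSF hx)).resolve_right hxF
      exact Nat.sub_self _
    rw [h1]
    refine (hsol.le (F' ∩ core G (A.erase u)) inter_subset_right ?_).trans
      (Nat.mul_le_mul_left _ (sum_le_sum_of_subset inter_subset_left))
    refine hE'.mono fun x hx => ?_
    have := mem_erase.1 (hBA (mem_sdiff.1 hx).1)
    simp only [mem_sdiff, mem_inter] at hx ⊢
    tauto
  · rw [mul_left_comm]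
    exact Nat.mul_le_mul_left _ (hg.sum_cliqueDegree_le hA hSA hSE hSmin hF' hE')

end LocalRatio

/-! ### The algorithm as a bounded loop program, and its correctness. -/

section Program

open Finset

/-! Logical connectives; a term is true when its value is nonzero. -/

def Tm.not (t : Tm) : Tm := .cond t (.const 0) (.const 1)
def Tm.and (t u : Tm) : Tm := .cond t u (.const 0)
def Tm.imp (t u : Tm) : Tm := .cond t u (.const 1)
def Tm.lt (t u : Tm) : Tm := .sub u t
def Tm.ne (t u : Tm) : Tm := .add (.sub t u) (.sub u t)
def Tm.all (x : ℕ) (t : Tm) : Tm := .not (.sum x (.not t))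

/-- The product of `t` and `u` if `u` is at most `n` and the variable `x` does not occur. -/
def Tm.mul (x : ℕ) (t u : Tm) : Tm := .sum x (.cond (.lt (.var x) u) t (.const 0))

/-- Membership of the variable `x` in the set that row `0` of array `a` represents. -/
def Tm.mem (a x : ℕ) : Tm := .read a (.const 0) (.var x)

def Tm.adj (x y : ℕ) : Tm := .and (.ne (.var x) (.var y)) (.read 0 (.var x) (.var y))

def Tm.Sat (n : ℕ) (σ : Mem) (ρ : ℕ → ℕ) (t : Tm) : Prop := t.eval n σ ρ ≠ 0

section
variable {n : ℕ} {σ : Mem} {ρ : ℕ → ℕ} (t u : Tm) (x y a : ℕ)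

theorem sat_not : t.not.Sat n σ ρ ↔ ¬ t.Sat n σ ρ := by
  by_cases h : t.eval n σ ρ = 0 <;> simp [Tm.Sat, Tm.not, Tm.eval, h]

theorem sat_and : (t.and u).Sat n σ ρ ↔ t.Sat n σ ρ ∧ u.Sat n σ ρ := by
  by_cases h : t.eval n σ ρ = 0 <;> simp [Tm.Sat, Tm.and, Tm.eval, h]

theorem sat_imp : (t.imp u).Sat n σ ρ ↔ (t.Sat n σ ρ → u.Sat n σ ρ) := by
  by_cases h : t.eval n σ ρ = 0 <;> simp [Tm.Sat, Tm.imp, Tm.eval, h]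

theorem sat_lt : (t.lt u).Sat n σ ρ ↔ t.eval n σ ρ < u.eval n σ ρ := by
  simp only [Tm.Sat, Tm.lt, Tm.eval]
  omega

theorem sat_ne : (t.ne u).Sat n σ ρ ↔ t.eval n σ ρ ≠ u.eval n σ ρ := by
  simp only [Tm.Sat, Tm.ne, Tm.eval]
  omega

theorem sat_sum : (Tm.sum x t).Sat n σ ρ ↔ ∃ i : Fin n, t.Sat n σ (Function.update ρ x i) := by
  simp [Tm.Sat, Tm.eval, Finset.sum_range]

theorem sat_all : (Tm.all x t).Sat n σ ρ ↔ ∀ i : Fin n, t.Sat n σ (Function.update ρ x i) := by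
  simp [Tm.all, sat_not, sat_sum]

theorem sat_mem : (Tm.mem a x).Sat n σ ρ ↔ σ a 0 (ρ x) ≠ 0 := Iff.rfl

theorem sat_adj : (Tm.adj x y).Sat n σ ρ ↔ ρ x ≠ ρ y ∧ σ 0 (ρ x) (ρ y) ≠ 0 := by
  rw [Tm.adj, sat_and, sat_ne]
  rfl

theorem sat_cond (c : Tm) : (Tm.cond c t u).Sat n σ ρ ↔
    (c.Sat n σ ρ ∧ t.Sat n σ ρ ∨ ¬ c.Sat n σ ρ ∧ u.Sat n σ ρ) := by
  by_cases h : c.eval n σ ρ = 0 <;> simp [Tm.Sat, Tm.eval, h]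

theorem sat_const (c : ℕ) : (Tm.const c).Sat n σ ρ ↔ c ≠ 0 := Iff.rfl

theorem eval_mul {v w : ℕ} (ht : ∀ i, t.eval n σ (Function.update ρ x i) = v)
    (hu : ∀ i, u.eval n σ (Function.update ρ x i) = w) (hw : w ≤ n) :
    (Tm.mul x t u).eval n σ ρ = v * w := by
  have h1 : ∀ i, (Tm.cond ((Tm.var x).lt u) t (.const 0)).eval n σ (Function.update ρ x i) =
      if i < w then v else 0 := by
    intro i
    have h2 := sat_lt (n := n) (σ := σ) (ρ := Function.update ρ x i) (.var x) u
    simp only [Tm.Sat] at h2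
    simp only [Tm.eval, h2, ht, hu, Function.update_self]
  simp only [Tm.mul, Tm.eval] at h1 ⊢
  simp only [h1]
  rw [← sum_filter, sum_const, smul_eq_mul, mul_comm]
  congr 1
  have : {i ∈ range n | i < w} = range w := by
    ext i
    simp only [mem_filter, mem_range]
    omega
  rw [this, card_range]

theorem run_set_self (t : Tm) {i j : ℕ} (hi : i < n) (hj : j < n) :
    (Stmt.set a t).run n ρ σ a i j = t.eval n σ (cellEnv ρ i j) := by
  simp [Stmt.run, setMem, hi, hj]

theorem run_set_of_ne {a b : ℕ} (t : Tm) (h : b ≠ a) : (Stmt.set a t).run n ρ σ b = σ b := by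
  funext i j
  simp [Stmt.run, setMem, h]

end

theorem iter_induct {α : Type*} {f : ℕ → α → α} {n : ℕ} {a : α} (P : ℕ → α → Prop) (h0 : P 0 a)
    (h : ∀ i < n, ∀ b, P i b → P (i + 1) (f i b)) : P n (iter f n a) := by
  have key : ∀ m ≤ n, P m (iter f m a) := by
    intro m
    induction m with
    | zero => exact fun _ => h0
    | succ m ih => exact fun hm => h m hm _ (ih (Nat.le_of_succ_le hm))
  exact key n le_rfl

variable {n : ℕ} (G : Graph n)

instance : DecidableRel G.adjacency.Adj := fun u v =>
  inferInstanceAs (Decidable (u ≠ v ∧ 0 < G.mult u v))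

def HasGraph (σ : Mem) : Prop := ∀ u v : Fin n, σ 0 u v = G.mult u v

/-- Row `i` of array `a` represents the set `A`. -/
def HasSet (σ : Mem) (a i : ℕ) (A : Finset (Fin n)) : Prop := ∀ v : Fin n, σ a i v ≠ 0 ↔ v ∈ A

variable {G}

theorem HasGraph.adj_iff {σ : Mem} (h : HasGraph G σ) (u v : Fin n) :
    ((u : ℕ) ≠ v ∧ σ 0 u v ≠ 0) ↔ G.adjacency.Adj u v := by
  rw [h u v]
  exact and_congr (by rw [Ne, Fin.val_inj]) Nat.pos_iff_ne_zero.symm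

/-! Deletion of simplicial vertices. -/

def simplicialTm (a : ℕ) : Tm :=
  .all 2 <| .all 3 <| .imp (.mem a 2) <| .imp (.mem a 3) <| .imp (.adj 1 2) <| .imp (.adj 1 3) <|
    .imp (.ne (.var 2) (.var 3)) (.adj 2 3)

def peelStmt (a : ℕ) : Stmt := .set a <| .and (.mem a 1) (.not (simplicialTm a))

def coreStmt (a : ℕ) : Stmt := .loop 10 (peelStmt a)

theorem hasGraph_congr {σ τ : Mem} (h : HasGraph G σ) (hτ : τ 0 = σ 0) : HasGraph G τ := by
  intro u v
  rw [hτ, h u v]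

theorem HasSet.congr {σ τ : Mem} {a i : ℕ} {A : Finset (Fin n)} (h : HasSet σ a i A)
    (hτ : τ a = σ a) : HasSet τ a i A := by
  intro v
  rw [hτ, h v]

theorem hasSet_run_set {σ : Mem} {ρ : ℕ → ℕ} {a i : ℕ} {t : Tm} {A : Finset (Fin n)}
    (hi : Fin n → i < n) (h : ∀ v : Fin n, t.Sat n σ (cellEnv ρ i v) ↔ v ∈ A) :
    HasSet ((Stmt.set a t).run n ρ σ) a i A := by
  intro v
  rw [run_set_self _ _ (hi v) v.2]
  exact h v

theorem HasSet.peelStmt {σ : Mem} (hG : HasGraph G σ) {a : ℕ} {A : Finset (Fin n)}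
    (h : HasSet σ a 0 A) (ρ : ℕ → ℕ) :
    HasSet ((peelStmt a).run n ρ σ) a 0 (peel G.adjacency A) := by
  refine hasSet_run_set Fin.pos fun v => ?_
  simp only [simplicialTm, sat_and, sat_not, sat_all, sat_imp, sat_mem, sat_ne, sat_adj, Tm.eval,
    cellEnv]
  simp [Function.update, peel, Simplicial, h v, ← hG.adj_iff, h _, Fin.ext_iff]

theorem HasSet.coreStmt {σ : Mem} (hG : HasGraph G σ) {a : ℕ} (ha : a ≠ 0) {A : Finset (Fin n)}
    (h : HasSet σ a 0 A) (ρ : ℕ → ℕ) :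
    HasSet ((coreStmt a).run n ρ σ) a 0 (core G.adjacency A) ∧
      ∀ b ≠ a, (coreStmt a).run n ρ σ b = σ b := by
  have key := iter_induct (f := fun i τ => (BGVD.peelStmt a).run n (Function.update ρ 10 i) τ)
    (n := n) (a := σ)
    (fun m τ => HasSet τ a 0 ((peel G.adjacency)^[m] A) ∧ ∀ b ≠ a, τ b = σ b)
    ⟨h, fun _ _ => rfl⟩ fun i hi τ hτ => by
      rw [Function.iterate_succ_apply']
      exact ⟨hτ.1.peelStmt (hasGraph_congr hG (hτ.2 0 ha.symm)) _,
        fun b hb => (run_set_of_ne _ hb).trans (hτ.2 b hb)⟩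
  rw [core, Fintype.card_fin]
  exact key

/-! The local ratio phase. Array `3` holds the current set, array `4` its weights, array `5` the
degrees, and the rows of the arrays `8` and `9` the former sets and the picked vertices. -/

def degreeTm : Tm :=
  .sum 2 <| .cond (.and (.mem 3 2) <| .and (.adj 1 2) <| .all 4 <| .imp (.mem 3 4) <|
    .imp (.lt (.var 4) (.var 2)) <| .imp (.adj 1 4) <| .not (.adj 4 2)) (.const 1) (.const 0)

theorem eval_degreeTm {σ : Mem} (hG : HasGraph G σ) {A : Finset (Fin n)} (h : HasSet σ 3 0 A)
    {ρ : ℕ → ℕ} {v : Fin n} (hρ : ρ 1 = v) :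
    degreeTm.eval n σ ρ = cliqueDegree G.adjacency A v := by
  classical
  have h1 : ∀ (c : Tm) (ρ : ℕ → ℕ), (Tm.cond c (.const 1) (.const 0)).eval n σ ρ =
      if c.Sat n σ ρ then 1 else 0 := fun c ρ => by
    by_cases h : c.eval n σ ρ = 0 <;> simp [Tm.eval, Tm.Sat, h]
  rw [degreeTm, Tm.eval, Finset.sum_range]
  simp only [h1]
  rw [← card_filter, cliqueDegree]
  congr 1
  ext u
  simp only [sat_and, sat_not, sat_all, sat_imp, sat_mem, sat_adj, sat_lt, Tm.eval]
  simp [Function.update, hρ, ← hG.adj_iff, h _]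

def atVar (a x : ℕ) : Tm := .read a (.const 0) (.var x)

def predAt (x : ℕ) : Tm := .sub (atVar 5 x) (.const 1)

def ratioMinTm : Tm :=
  .and (.mem 3 1) <| .all 2 <| .imp (.mem 3 2) <|
    .not (.lt (.mul 4 (atVar 4 2) (predAt 1)) (.mul 4 (atVar 4 1) (predAt 2)))

def pickTm : Tm :=
  .and (.mem 6 1) <| .all 2 <| .imp (.lt (.var 2) (.var 1)) <| .not (.mem 6 2)

def weightTm : Tm :=
  .sum 2 <| .cond (.mem 7 2)
    (.sub (.mul 4 (atVar 4 1) (predAt 2)) (.mul 4 (atVar 4 2) (predAt 1))) (.const 0)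

/-- Record row `0` of array `b` in row `k` (variable `11`) of array `a`. -/
def recordStmt (a b : ℕ) : Stmt :=
  .set a <| .cond (.ne (.var 0) (.var 11)) (.read a (.var 0) (.var 1)) (.mem b 1)

def ratioStmt : Stmt :=
  .seq (.set 5 degreeTm) <| .seq (.set 6 ratioMinTm) <| .seq (.set 7 pickTm) <|
  .seq (recordStmt 8 3) <| .seq (recordStmt 9 7) <| .seq (.set 4 weightTm) <|
  .seq (.set 3 (.and (.mem 3 1) (.not (.mem 7 1)))) (coreStmt 3)

theorem cliqueDegree_le (H : SimpleGraph (Fin n)) [DecidableRel H.Adj] (A : Finset (Fin n))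
    (v : Fin n) : cliqueDegree H A v ≤ n :=
  (card_le_univ _).trans (Fintype.card_fin n).le

theorem eval_mul_atVar {σ : Mem} {w d : Fin n → ℕ} (hw : ∀ v : Fin n, σ 4 0 v = w v)
    (hd : ∀ v : Fin n, σ 5 0 v = d v) (hn : ∀ v, d v ≤ n) {ρ : ℕ → ℕ} {x y : ℕ} (hx : x ≠ 4)
    (hy : y ≠ 4) {u v : Fin n} (hu : ρ x = u) (hv : ρ y = v) :
    (Tm.mul 4 (atVar 4 x) (predAt y)).eval n σ ρ = w u * (d v - 1) := by
  refine eval_mul _ _ _ (fun i => ?_) (fun i => ?_) ((Nat.sub_le _ _).trans (hn v))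
  · simp [atVar, Tm.eval, Function.update, hx, hu, hw]
  · simp [predAt, atVar, Tm.eval, Function.update, hy, hv, hd]

theorem recordStmt_run {σ : Mem} {ρ : ℕ → ℕ} {a b k : ℕ} (hρ : ρ 11 = k) (hk : k < n)
    {A : Finset (Fin n)} (h : HasSet σ b 0 A) :
    HasSet ((recordStmt a b).run n ρ σ) a k A ∧
    (∀ j < k, ∀ B : Finset (Fin n), HasSet σ a j B → HasSet ((recordStmt a b).run n ρ σ) a j B) ∧
    ∀ c ≠ a, (recordStmt a b).run n ρ σ c = σ c := by
  refine ⟨hasSet_run_set (fun _ => hk) fun v => ?_, fun j hj B hB =>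
    hasSet_run_set (fun _ => hj.trans hk) fun v => ?_, fun c hc => run_set_of_ne _ hc⟩
  · simp only [sat_cond, sat_ne, sat_mem, Tm.eval, cellEnv]
    simp [Function.update, hρ, h v]
  · simp only [sat_cond, sat_ne, sat_mem, Tm.eval, cellEnv]
    simp [Function.update, hρ, hj.ne, Tm.Sat, Tm.eval, hB v]

variable (G) in
/-- The states of the local ratio algorithm started on the core of `A`. -/
def ratioState (A : Finset (Fin n)) (k : ℕ) : Finset (Fin n) × (Fin n → ℕ) :=
  (ratioStep G.adjacency)^[k] (core G.adjacency A, fun _ => 1)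

variable (G) in
structure RatioInv (A : Finset (Fin n)) (k : ℕ) (σ : Mem) : Prop where
  graph : HasGraph G σ
  alive : HasSet σ 2 0 A
  cur : HasSet σ 3 0 (ratioState G A k).1
  weight : ∀ v : Fin n, σ 4 0 v = (ratioState G A k).2 v
  sets : ∀ j < k, HasSet σ 8 j (ratioState G A j).1
  picks : ∀ j < k, HasSet σ 9 j
    (pick G.adjacency (ratioState G A j).1 (ratioState G A j).2)
  out : HasSet σ 1 0 (∅ : Finset (Fin n))

theorem RatioInv.step {A : Finset (Fin n)} {k : ℕ} {σ : Mem} (h : RatioInv G A k σ) (hk : k < n)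
    {ρ : ℕ → ℕ} (hρ : ρ 11 = k) : RatioInv G A (k + 1) (ratioStmt.run n ρ σ) := by
  have hst : ratioState G A (k + 1) = ratioStep G.adjacency (ratioState G A k) :=
    Function.iterate_succ_apply' _ _ _
  obtain ⟨hG, hal, hcur, hw, hsets, hpicks, hout⟩ := h
  set B := (ratioState G A k).1 with hB
  set w := (ratioState G A k).2 with hwdef
  simp only [ratioStmt, Stmt.run.eq_2]
  have hd := cliqueDegree_le G.adjacency B
  -- degrees
  set σ₁ := (Stmt.set 5 degreeTm).run n ρ σ with hσ₁
  have f₁ : ∀ b ≠ 5, σ₁ b = σ b := fun b hb => run_set_of_ne _ hb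
  have d₁ : ∀ v : Fin n, σ₁ 5 0 v = cliqueDegree G.adjacency B v := fun v => by
    rw [hσ₁, run_set_self _ _ v.pos v.2, eval_degreeTm hG hcur]
    simp [cellEnv]
  clear_value σ₁
  have c₁ := hcur.congr (f₁ 3 (by decide))
  have w₁ : ∀ v : Fin n, σ₁ 4 0 v = w v := fun v => by rw [f₁ 4 (by decide), hw]
  -- vertices of minimum ratio
  set σ₂ := (Stmt.set 6 ratioMinTm).run n ρ σ₁ with hσ₂
  have f₂ : ∀ b ≠ 6, σ₂ b = σ₁ b := fun b hb => run_set_of_ne _ hb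
  have m₂ : HasSet σ₂ 6 0 ({v | IsRatioMin G.adjacency B w v} : Finset (Fin n)) := by
    refine hasSet_run_set Fin.pos fun v => ?_
    simp only [ratioMinTm, sat_and, sat_all, sat_imp, sat_not, sat_lt, sat_mem]
    rw [mem_filter]
    simp only [mem_univ, true_and, IsRatioMin]
    refine and_congr (by simpa [cellEnv, Function.update] using c₁ v) (forall_congr' fun x =>
      imp_congr (by simpa [cellEnv, Function.update] using c₁ x) ?_)
    rw [eval_mul_atVar w₁ d₁ hd (by decide) (by decide) (u := x) (v := v) (by simp)
        (by simp [cellEnv, Function.update]),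
      eval_mul_atVar w₁ d₁ hd (by decide) (by decide) (u := v) (v := x)
        (by simp [cellEnv, Function.update]) (by simp), not_lt]
  clear_value σ₂
  -- the picked vertex
  set σ₃ := (Stmt.set 7 pickTm).run n ρ σ₂ with hσ₃
  have f₃ : ∀ b ≠ 7, σ₃ b = σ₂ b := fun b hb => run_set_of_ne _ hb
  have p₃ : HasSet σ₃ 7 0 (pick G.adjacency B w) := by
    refine hasSet_run_set Fin.pos fun v => ?_
    simp only [pickTm, sat_and, sat_all, sat_imp, sat_not, sat_lt, sat_mem, pick, Tm.eval]
    simp only [mem_filter, mem_univ, true_and]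
    refine and_congr (by simpa [cellEnv, Function.update] using m₂ v) (forall_congr' fun x =>
      imp_congr (by simp [cellEnv, Function.update])
        (not_congr (by simpa [cellEnv, Function.update] using m₂ x)))
  clear_value σ₃
  have c₃ : HasSet σ₃ 3 0 B := (c₁.congr (f₂ 3 (by decide))).congr (f₃ 3 (by decide))
  -- records
  obtain ⟨r₄, s₄, f₄⟩ := recordStmt_run (a := 8) hρ hk c₃
  set σ₄ := (recordStmt 8 3).run n ρ σ₃
  clear_value σ₄
  obtain ⟨r₅, s₅, f₅⟩ := recordStmt_run (a := 9) hρ hk (p₃.congr (f₄ 7 (by decide)))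
  set σ₅ := (recordStmt 9 7).run n ρ σ₄
  clear_value σ₅
  have p₅ : HasSet σ₅ 7 0 (pick G.adjacency B w) :=
    (p₃.congr (f₄ 7 (by decide))).congr (f₅ 7 (by decide))
  have c₅ : HasSet σ₅ 3 0 B := (c₃.congr (f₄ 3 (by decide))).congr (f₅ 3 (by decide))
  have w₅ : ∀ v : Fin n, σ₅ 4 0 v = w v := fun v => by
    rw [f₅ 4 (by decide), f₄ 4 (by decide), f₃ 4 (by decide), f₂ 4 (by decide), w₁]
  have d₅ : ∀ v : Fin n, σ₅ 5 0 v = cliqueDegree G.adjacency B v := fun v => by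
    rw [f₅ 5 (by decide), f₄ 5 (by decide), f₃ 5 (by decide), f₂ 5 (by decide), d₁]
  -- weights
  set σ₆ := (Stmt.set 4 weightTm).run n ρ σ₅ with hσ₆
  have f₆ : ∀ b ≠ 4, σ₆ b = σ₅ b := fun b hb => run_set_of_ne _ hb
  have w₆ : ∀ v : Fin n, σ₆ 4 0 v = (ratioStep G.adjacency (ratioState G A k)).2 v := by
    intro v
    have key : ∀ u : Fin n, Tm.eval n σ₅ (.cond (.mem 7 2) (.sub (.mul 4 (atVar 4 1) (predAt 2))
        (.mul 4 (atVar 4 2) (predAt 1))) (.const 0)) (Function.update (cellEnv ρ 0 v) 2 u) =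
        if u ∈ pick G.adjacency B w then w v * (cliqueDegree G.adjacency B u - 1) -
          w u * (cliqueDegree G.adjacency B v - 1) else 0 := by
      intro u
      simp only [Tm.eval]
      rw [eval_mul_atVar w₅ d₅ hd (by decide) (by decide) (u := v) (v := u)
          (by simp [cellEnv, Function.update]) (by simp),
        eval_mul_atVar w₅ d₅ hd (by decide) (by decide) (u := u) (v := v) (by simp)
          (by simp [cellEnv, Function.update])]
      exact if_congr (by simpa [Tm.mem, Tm.eval] using p₅ u) rfl rfl
    rw [hσ₆, run_set_self _ _ v.pos v.2, weightTm, Tm.eval, Finset.sum_range,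
      sum_congr rfl fun u _ => key u, sum_ite_mem, univ_inter]
    rfl
  clear_value σ₆
  have c₆ := c₅.congr (f₆ 3 (by decide))
  have p₆ := p₅.congr (f₆ 7 (by decide))
  -- deletion of the picked vertex
  set σ₇ := (Stmt.set 3 (.and (.mem 3 1) (.not (.mem 7 1)))).run n ρ σ₆ with hσ₇
  have f₇ : ∀ b ≠ 3, σ₇ b = σ₆ b := fun b hb => run_set_of_ne _ hb
  have c₇ : HasSet σ₇ 3 0 (B \ pick G.adjacency B w) := by
    refine hasSet_run_set Fin.pos fun v => ?_
    simp only [sat_and, sat_not, sat_mem, mem_sdiff]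
    exact and_congr (by simpa [cellEnv, Function.update] using c₆ v)
      (not_congr (by simpa [cellEnv, Function.update] using p₆ v))
  clear_value σ₇
  have e₇ : ∀ b, b ≠ 3 → b ≠ 4 → b ≠ 5 → b ≠ 6 → b ≠ 7 → b ≠ 8 → b ≠ 9 → σ₇ b = σ b := by
    intro b h3 h4 h5 h6 h7 h8 h9
    rw [f₇ b h3, f₆ b h4, f₅ b h9, f₄ b h8, f₃ b h7, f₂ b h6, f₁ b h5]
  have g₇ : HasGraph G σ₇ := hasGraph_congr hG (e₇ 0 (by decide) (by decide) (by decide)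
    (by decide) (by decide) (by decide) (by decide))
  obtain ⟨c₈, f₈⟩ := c₇.coreStmt g₇ (by decide) ρ
  set σ₈ := (coreStmt 3).run n ρ σ₇
  clear_value σ₈
  refine ⟨hasGraph_congr g₇ (f₈ 0 (by decide)), ?_, ?_, ?_, ?_, ?_, ?_⟩
  · refine hal.congr ((f₈ 2 (by decide)).trans (e₇ 2 ?_ ?_ ?_ ?_ ?_ ?_ ?_)) <;> decide
  · rw [hst]
    exact c₈
  · intro v
    rw [f₈ 4 (by decide), f₇ 4 (by decide), w₆, hst]
  · have h8 : σ₈ 8 = σ₄ 8 := by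
      rw [f₈ 8 (by decide), f₇ 8 (by decide), f₆ 8 (by decide), f₅ 8 (by decide)]
    have h8' : σ₃ 8 = σ 8 := by
      rw [f₃ 8 (by decide), f₂ 8 (by decide), f₁ 8 (by decide)]
    intro j hj
    rcases Nat.lt_succ_iff_lt_or_eq.1 hj with hj | rfl
    · exact (s₄ j hj _ ((hsets j hj).congr h8')).congr h8
    · exact r₄.congr h8
  · have h9 : σ₈ 9 = σ₅ 9 := by
      rw [f₈ 9 (by decide), f₇ 9 (by decide), f₆ 9 (by decide)]
    have h9' : σ₄ 9 = σ 9 := by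
      rw [f₄ 9 (by decide), f₃ 9 (by decide), f₂ 9 (by decide), f₁ 9 (by decide)]
    intro j hj
    rcases Nat.lt_succ_iff_lt_or_eq.1 hj with hj | rfl
    · exact (s₅ j hj _ ((hpicks j hj).congr h9')).congr h9
    · exact r₅.congr h9
  · refine hout.congr ((f₈ 1 (by decide)).trans (e₇ 1 ?_ ?_ ?_ ?_ ?_ ?_ ?_)) <;> decide

/-! Reverse deletion. Array `1` holds the solution. -/

/-- The row that is treated in the iteration that variable `11` counts. -/
def rowTm : Tm := .sub (.sub (.sum 2 (.const 1)) (.const 1)) (.var 11)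

def reverseStmt : Stmt :=
  .seq (.set 10 (.and (.read 8 rowTm (.var 1)) (.not (.mem 1 1)))) <| .seq (coreStmt 10) <|
  .set 1 <| .cond (.mem 1 1) (.const 1) <| .and (.sum 2 (.mem 10 2)) (.read 9 rowTm (.var 1))

theorem ratioState_solve (A : Finset (Fin n)) (k : ℕ) :
    ∀ m, solve G.adjacency (m + 1) (ratioState G A k) =
      if core G.adjacency ((ratioState G A k).1 \ solve G.adjacency m (ratioState G A (k + 1))) = ∅
      then solve G.adjacency m (ratioState G A (k + 1))
      else solve G.adjacency m (ratioState G A (k + 1)) ∪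
        pick G.adjacency (ratioState G A k).1 (ratioState G A k).2 := by
  intro m
  rw [show ratioState G A (k + 1) = ratioStep G.adjacency (ratioState G A k) from
    Function.iterate_succ_apply' _ _ _]
  rfl

-- After `m` reverse rounds array `1` holds the solution for the state that has `m` local ratio
-- rounds ahead of it.
variable (G) in
structure ReverseInv (A : Finset (Fin n)) (m : ℕ) (σ : Mem) : Prop where
  graph : HasGraph G σ
  alive : HasSet σ 2 0 A
  sets : ∀ j < n, HasSet σ 8 j (ratioState G A j).1
  picks : ∀ j < n, HasSet σ 9 j
    (pick G.adjacency (ratioState G A j).1 (ratioState G A j).2)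
  out : HasSet σ 1 0 (solve G.adjacency m (ratioState G A (n - m)))

theorem ReverseInv.step {A : Finset (Fin n)} {m : ℕ} {σ : Mem} (h : ReverseInv G A m σ) (hm : m < n)
    {ρ : ℕ → ℕ} (hρ : ρ 11 = m) : ReverseInv G A (m + 1) (reverseStmt.run n ρ σ) := by
  obtain ⟨hG, hal, hsets, hpicks, hout⟩ := h
  have hk : n - 1 - m < n := by omega
  have hsolve := ratioState_solve (G := G) A (n - 1 - m) m
  rw [show n - 1 - m + 1 = n - m by omega] at hsolve
  set F := solve G.adjacency m (ratioState G A (n - m)) with hF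
  simp only [reverseStmt, Stmt.run.eq_2]
  have hrow : ∀ (τ : Mem) (v : Fin n), rowTm.eval n τ (cellEnv ρ 0 v) = n - 1 - m := by
    intro τ v
    simp [rowTm, Tm.eval, cellEnv, Function.update, hρ]
  set σ₁ := (Stmt.set 10 (.and (.read 8 rowTm (.var 1)) (.not (.mem 1 1)))).run n ρ σ with hσ₁
  have f₁ : ∀ b ≠ 10, σ₁ b = σ b := fun b hb => run_set_of_ne _ hb
  have t₁ : HasSet σ₁ 10 0 ((ratioState G A (n - 1 - m)).1 \ F) := by
    refine hasSet_run_set Fin.pos fun v => ?_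
    simp only [sat_and, sat_not, sat_mem, mem_sdiff]
    refine and_congr ?_ (not_congr (by simpa [cellEnv, Function.update] using hout v))
    rw [← hsets _ hk v]
    simp only [Tm.Sat, Tm.eval, hrow]
    simp [cellEnv]
  clear_value σ₁
  obtain ⟨t₂, f₂⟩ := t₁.coreStmt (hasGraph_congr hG (f₁ 0 (by decide))) (by decide) ρ
  set σ₂ := (coreStmt 10).run n ρ σ₁
  clear_value σ₂
  have e₂ : ∀ b ≠ 10, σ₂ b = σ b := fun b hb => (f₂ b hb).trans (f₁ b hb)
  have o₂ := hout.congr (e₂ 1 (by decide))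
  have p₂ := (hpicks _ hk).congr (e₂ 9 (by decide))
  have f₃ : ∀ b, b ≠ 1 → b ≠ 10 → (Stmt.set 1 (.cond (.mem 1 1) (.const 1) (.and (.sum 2 (.mem 10 2))
      (.read 9 rowTm (.var 1))))).run n ρ σ₂ b = σ b :=
    fun b hb hb' => (run_set_of_ne _ hb).trans (e₂ b hb')
  refine ⟨hasGraph_congr hG (f₃ 0 (by decide) (by decide)), hal.congr (f₃ 2 (by decide) (by decide)),
    fun j hj => (hsets j hj).congr (f₃ 8 (by decide) (by decide)),
    fun j hj => (hpicks j hj).congr (f₃ 9 (by decide) (by decide)), ?_⟩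
  rw [show n - (m + 1) = n - 1 - m by omega, hsolve]
  refine hasSet_run_set Fin.pos fun v => ?_
  simp only [sat_cond, sat_const, sat_and, sat_sum, sat_mem]
  have h1 : σ₂ 1 0 (cellEnv ρ 0 v 1) ≠ 0 ↔ v ∈ F := by
    simpa [cellEnv] using o₂ v
  have h2 : (∃ i : Fin n, σ₂ 10 0 (Function.update (cellEnv ρ 0 v) 2 i 2) ≠ 0) ↔
      core G.adjacency ((ratioState G A (n - 1 - m)).1 \ F) ≠ ∅ := by
    rw [← nonempty_iff_ne_empty]
    exact exists_congr fun i => by simpa using t₂ i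
  have h3 : (Tm.read 9 rowTm (.var 1)).Sat n σ₂ (cellEnv ρ 0 v) ↔
      v ∈ pick G.adjacency (ratioState G A (n - 1 - m)).1 (ratioState G A (n - 1 - m)).2 := by
    rw [← p₂ v]
    simp only [Tm.Sat, Tm.eval, hrow]
    simp [cellEnv]
  rw [h1, h2, h3]
  split_ifs with hc
  · simp [hc]
  · simp only [ne_eq, one_ne_zero, not_false_eq_true, and_true, hc, true_and, mem_union]
    tauto

/-! Deletion of disjoint induced four-cycles and diamonds. -/

def badTm : Tm :=
  .and (.mem 2 2) <| .and (.mem 2 3) <| .and (.mem 2 4) <| .and (.mem 2 5) <| .and (.adj 2 3) <|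
  .and (.adj 3 4) <| .and (.adj 4 5) <| .and (.adj 5 2) <| .and (.ne (.var 2) (.var 4)) <|
  .and (.ne (.var 3) (.var 5)) <| .not (.adj 2 4)

def killStmt : Stmt :=
  .set 2 <| .and (.mem 2 1) <| .not <| .and badTm <| .not <|
    .and (.ne (.var 1) (.var 2)) <| .and (.ne (.var 1) (.var 3)) <| .and (.ne (.var 1) (.var 4)) <|
    .ne (.var 1) (.var 5)

def cleanStmt : Stmt := .loop 2 <| .loop 3 <| .loop 4 <| .loop 5 killStmt

/-- Vertices `a, b, c, d` of the current set form a four-cycle without the chord `ac`. -/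
def BadAt (σ : Mem) (a b c d : ℕ) : Prop :=
  σ 2 0 a ≠ 0 ∧ σ 2 0 b ≠ 0 ∧ σ 2 0 c ≠ 0 ∧ σ 2 0 d ≠ 0 ∧ (a ≠ b ∧ σ 0 a b ≠ 0) ∧
  (b ≠ c ∧ σ 0 b c ≠ 0) ∧ (c ≠ d ∧ σ 0 c d ≠ 0) ∧ (d ≠ a ∧ σ 0 d a ≠ 0) ∧ a ≠ c ∧ b ≠ d ∧
  ¬ (a ≠ c ∧ σ 0 a c ≠ 0)

def aliveSet (n : ℕ) (σ : Mem) : Finset (Fin n) := {v | σ 2 0 v ≠ 0}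

/-- Only vertices of the current set are deleted, at most four for each vertex of a set that meets
all induced four-cycles and diamonds. -/
structure CleanStep (G : Graph n) (σ τ : Mem) : Prop where
  eq : ∀ b ≠ 2, τ b = σ b
  le : ∀ v, τ 2 0 v ≠ 0 → σ 2 0 v ≠ 0
  card : ∀ S : Finset (Fin n), Good G.adjacency Sᶜ →
    #(aliveSet n σ \ aliveSet n τ) ≤ 4 * #(S ∩ (aliveSet n σ \ aliveSet n τ))

theorem CleanStep.refl (σ : Mem) : CleanStep G σ σ := ⟨fun _ _ => rfl, fun _ h => h, by simp⟩

theorem CleanStep.alive_subset {σ τ : Mem} (h : CleanStep G σ τ) : aliveSet n τ ⊆ aliveSet n σ :=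
  fun v hv => mem_filter.2 ⟨mem_univ _, h.le v (mem_filter.1 hv).2⟩

theorem CleanStep.trans {σ τ υ : Mem} (h : CleanStep G σ τ) (h' : CleanStep G τ υ) :
    CleanStep G σ υ := by
  refine ⟨fun b hb => (h'.eq b hb).trans (h.eq b hb), fun v hv => h.le v (h'.le v hv),
    fun S hS => ?_⟩
  have he : aliveSet n σ \ aliveSet n υ =
      (aliveSet n σ \ aliveSet n τ) ∪ (aliveSet n τ \ aliveSet n υ) := by
    have h1 := h.alive_subset
    have h2 := h'.alive_subset
    ext v
    have := @h1 v
    have := @h2 v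
    simp only [mem_union, mem_sdiff]
    tauto
  have hdis : Disjoint (aliveSet n σ \ aliveSet n τ) (aliveSet n τ \ aliveSet n υ) :=
    disjoint_left.2 fun v hv hv' => (mem_sdiff.1 hv).2 (mem_sdiff.1 hv').1
  rw [he, inter_union_distrib_left, card_union_of_disjoint hdis,
    card_union_of_disjoint (hdis.mono inter_subset_right inter_subset_right), mul_add]
  exact add_le_add (h.card S hS) (h'.card S hS)

theorem CleanStep.badAt {σ τ : Mem} (h : CleanStep G σ τ) {a b c d : ℕ} (hb : BadAt τ a b c d) :
    BadAt σ a b c d := by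
  obtain ⟨h1, h2, h3, h4, h5⟩ := hb
  rw [h.eq 0 (by decide)] at h5
  exact ⟨h.le _ h1, h.le _ h2, h.le _ h3, h.le _ h4, h5⟩

/-- One level of the nested loops: what iteration `i` achieves persists, because later iterations
only delete vertices. -/
theorem CleanStep.iter {σ : Mem} (hG : HasGraph G σ) {f : ℕ → Mem → Mem} {P : ℕ → Mem → Prop}
    (hP : ∀ i τ υ, CleanStep G τ υ → P i τ → P i υ)
    (hf : ∀ i < n, ∀ τ, HasGraph G τ → CleanStep G τ (f i τ) ∧ P i (f i τ)) :
    CleanStep G σ (iter f n σ) ∧ ∀ i < n, P i (iter f n σ) := by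
  refine iter_induct (fun m τ => CleanStep G σ τ ∧ ∀ i < m, P i τ) ⟨.refl σ, by simp⟩ ?_
  rintro i hi τ ⟨h1, h2⟩
  obtain ⟨h3, h4⟩ := hf i hi τ (hasGraph_congr hG (h1.eq 0 (by decide)))
  refine ⟨h1.trans h3, fun j hj => ?_⟩
  rcases Nat.lt_succ_iff_lt_or_eq.1 hj with hj | rfl
  · exact hP j _ _ h3 (h2 j hj)
  · exact h4

theorem killStmt_run {σ : Mem} (hG : HasGraph G σ) {ρ : ℕ → ℕ} {a b c d : ℕ} (ha : ρ 2 = a)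
    (hb : ρ 3 = b) (hc : ρ 4 = c) (hd : ρ 5 = d) (han : a < n) (hbn : b < n) (hcn : c < n)
    (hdn : d < n) :
    CleanStep G σ (killStmt.run n ρ σ) ∧ ¬ BadAt (killStmt.run n ρ σ) a b c d := by
  have hrun : ∀ v < n, killStmt.run n ρ σ 2 0 v ≠ 0 ↔ σ 2 0 v ≠ 0 ∧
      ¬ (BadAt σ a b c d ∧ ¬ (v ≠ a ∧ v ≠ b ∧ v ≠ c ∧ v ≠ d)) := by
    intro v hv
    rw [killStmt, run_set_self _ _ (by omega) hv]
    change Tm.Sat _ _ _ _ ↔ _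
    simp only [badTm, sat_and, sat_not, sat_mem, sat_ne, sat_adj, Tm.eval, cellEnv, BadAt]
    simp only [Function.update, ha, hb, hc, hd]
    rfl
  have hle : ∀ v, killStmt.run n ρ σ 2 0 v ≠ 0 → σ 2 0 v ≠ 0 := by
    intro v hv
    by_cases hvn : v < n
    · exact ((hrun v hvn).1 hv).1
    · simpa [killStmt, Stmt.run, setMem, hvn] using hv
  have heq : ∀ b ≠ 2, killStmt.run n ρ σ b = σ b := fun b hb => run_set_of_ne _ hb
  refine ⟨⟨heq, hle, fun S hS => ?_⟩, fun hbad => ?_⟩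
  · by_cases hbad : BadAt σ a b c d
    · have hdel : ∀ v : Fin n, v ∈ aliveSet n σ \ aliveSet n (killStmt.run n ρ σ) ↔
          v ∈ ({⟨a, han⟩, ⟨b, hbn⟩, ⟨c, hcn⟩, ⟨d, hdn⟩} : Finset (Fin n)) := by
        intro v
        simp only [aliveSet, mem_sdiff, mem_filter, mem_univ, true_and, hrun v v.2, hbad,
          mem_insert, mem_singleton, Fin.ext_iff]
        obtain ⟨h1, h2, h3, h4, -⟩ := hbad
        constructor
        · tauto
        · rintro (h | h | h | h) <;> simp [h, h1, h2, h3, h4]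
      rw [show aliveSet n σ \ aliveSet n (killStmt.run n ρ σ) = _ from Finset.ext hdel]
      -- Otherwise all four vertices lie in `Sᶜ`, where `Good` provides the missing chord.
      have hne : (S ∩ {⟨a, han⟩, ⟨b, hbn⟩, ⟨c, hcn⟩, ⟨d, hdn⟩}).Nonempty := by
        by_contra hemp
        rw [not_nonempty_iff_eq_empty, ← disjoint_iff_inter_eq_empty, disjoint_comm,
          disjoint_left] at hemp
        have hmem : ∀ x ∈ ({⟨a, han⟩, ⟨b, hbn⟩, ⟨c, hcn⟩, ⟨d, hdn⟩} : Finset (Fin n)), x ∈ Sᶜ :=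
          fun x hx => mem_compl.2 (hemp hx)
        obtain ⟨-, -, -, -, h1, h2, h3, h4, h5, h6, h7⟩ := hbad
        have hac := hS ⟨a, han⟩ (hmem _ (by simp)) ⟨b, hbn⟩ (hmem _ (by simp)) ⟨c, hcn⟩
          (hmem _ (by simp)) ⟨d, hdn⟩ (hmem _ (by simp)) ((hG.adj_iff _ _).1 h1)
          ((hG.adj_iff _ _).1 h2) ((hG.adj_iff _ _).1 h3) ((hG.adj_iff _ _).1 h4)
          (fun h => h5 (congrArg Fin.val h)) fun h => h6 (congrArg Fin.val h)
        exact h7 ((hG.adj_iff _ _).2 hac)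
      exact card_le_four.trans (by have := card_pos.2 hne; omega)
    · have : aliveSet n σ \ aliveSet n (killStmt.run n ρ σ) = ∅ := by
        refine sdiff_eq_empty_iff_subset.2 fun v hv => mem_filter.2 ⟨mem_univ _, ?_⟩
        rw [hrun v v.2]
        exact ⟨(mem_filter.1 hv).2, fun h => hbad h.1⟩
      simp [this]
  · have h1 := (hrun a han).1 hbad.1
    refine h1.2 ⟨?_, fun h => h.1 rfl⟩
    obtain ⟨h1, h2, h3, h4, h5⟩ := hbad
    rw [heq 0 (by decide)] at h5
    exact ⟨hle _ h1, hle _ h2, hle _ h3, hle _ h4, h5⟩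

theorem cleanStmt_run {σ : Mem} (hG : HasGraph G σ) (ρ : ℕ → ℕ) :
    CleanStep G σ (cleanStmt.run n ρ σ) ∧
      Good G.adjacency (aliveSet n (cleanStmt.run n ρ σ)) := by
  have h : CleanStep G σ (cleanStmt.run n ρ σ) ∧ ∀ a < n, ∀ b < n, ∀ c < n, ∀ d < n,
      ¬ BadAt (cleanStmt.run n ρ σ) a b c d := by
    refine CleanStep.iter (P := fun a τ => ∀ b < n, ∀ c < n, ∀ d < n, ¬ BadAt τ a b c d) hG
      (fun a τ υ h hP b hb c hc d hd hbad => hP b hb c hc d hd (h.badAt hbad))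
      fun a ha τ₁ hG₁ => ?_
    refine CleanStep.iter (P := fun b τ => ∀ c < n, ∀ d < n, ¬ BadAt τ a b c d) hG₁
      (fun b τ υ h hP c hc d hd hbad => hP c hc d hd (h.badAt hbad)) fun b hb τ₂ hG₂ => ?_
    refine CleanStep.iter (P := fun c τ => ∀ d < n, ¬ BadAt τ a b c d) hG₂
      (fun c τ υ h hP d hd hbad => hP d hd (h.badAt hbad)) fun c hc τ₃ hG₃ => ?_
    refine CleanStep.iter (P := fun d τ => ¬ BadAt τ a b c d) hG₃
      (fun d τ υ h hP hbad => hP (h.badAt hbad)) fun d hd τ₄ hG₄ => ?_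
    exact killStmt_run hG₄ rfl rfl rfl rfl ha hb hc hd
  refine ⟨h.1, fun a ha b hb c hc d hd hab hbc hcd hda hac hbd => ?_⟩
  have hG' := hasGraph_congr hG (h.1.eq 0 (by decide))
  by_contra hnac
  refine h.2 a a.2 b b.2 c c.2 d d.2 ⟨(mem_filter.1 ha).2, (mem_filter.1 hb).2,
    (mem_filter.1 hc).2, (mem_filter.1 hd).2, (hG'.adj_iff _ _).2 hab, (hG'.adj_iff _ _).2 hbc,
    (hG'.adj_iff _ _).2 hcd, (hG'.adj_iff _ _).2 hda, fun h => hac (Fin.ext h),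
    fun h => hbd (Fin.ext h), fun h => hnac ((hG'.adj_iff _ _).1 h)⟩

/-! The whole algorithm. -/

def algorithm : Stmt :=
  .seq (.set 2 (.const 1)) <| .seq cleanStmt <| .seq (.set 3 (.mem 2 1)) <| .seq (coreStmt 3) <|
  .seq (.set 4 (.const 1)) <| .seq (.loop 11 ratioStmt) <| .seq (.loop 11 reverseStmt) <|
  .set 1 <| .cond (.mem 1 1) (.const 1) (.not (.mem 2 1))

/-- `A` is the set that survives the cleaning. The bound charges only `S ∩ Aᶜ`, which leaves `S ∩ A`
to pay for the local ratio phase. -/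
theorem algorithm_run (ρ : ℕ → ℕ) {σ : Mem} (hG : HasGraph G σ)
    (h1 : HasSet σ 1 0 (∅ : Finset (Fin n))) : ∃ A : Finset (Fin n),
    Good G.adjacency A ∧
    (∀ S, Good G.adjacency Sᶜ → #Aᶜ ≤ 4 * #(S ∩ Aᶜ)) ∧
    HasSet (algorithm.run n ρ σ) 1 0
      (solve G.adjacency n (core G.adjacency A, fun _ => 1) ∪ Aᶜ) := by
  simp only [algorithm, Stmt.run.eq_2]
  set σ₁ := (Stmt.set 2 (.const 1)).run n ρ σ with hσ₁
  have f₁ : ∀ b ≠ 2, σ₁ b = σ b := fun b hb => run_set_of_ne _ hb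
  have a₁ : aliveSet n σ₁ = univ := by
    refine filter_true_of_mem fun v _ => ?_
    rw [hσ₁, run_set_self _ _ v.pos v.2]
    exact one_ne_zero
  clear_value σ₁
  obtain ⟨s₂, g₂⟩ := cleanStmt_run (hasGraph_congr hG (f₁ 0 (by decide))) ρ
  set σ₂ := cleanStmt.run n ρ σ₁
  clear_value σ₂
  set A := aliveSet n σ₂ with hA
  have A₂ : HasSet σ₂ 2 0 A := fun v => by simp [hA, aliveSet]
  set σ₃ := (Stmt.set 3 (.mem 2 1)).run n ρ σ₂ with hσ₃
  have f₃ : ∀ b ≠ 3, σ₃ b = σ₂ b := fun b hb => run_set_of_ne _ hb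
  have c₃ : HasSet σ₃ 3 0 A := hasSet_run_set Fin.pos fun v => by
    simpa [sat_mem, cellEnv] using A₂ v
  clear_value σ₃
  have e₃ : ∀ b, b ≠ 2 → b ≠ 3 → σ₃ b = σ b := fun b h2 h3 => by
    rw [f₃ b h3, s₂.eq b h2, f₁ b h2]
  obtain ⟨c₄, f₄⟩ := c₃.coreStmt (hasGraph_congr hG (e₃ 0 (by decide) (by decide))) (by decide) ρ
  set σ₄ := (coreStmt 3).run n ρ σ₃
  clear_value σ₄
  set σ₅ := (Stmt.set 4 (.const 1)).run n ρ σ₄ with hσ₅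
  have f₅ : ∀ b ≠ 4, σ₅ b = σ₄ b := fun b hb => run_set_of_ne _ hb
  have e₅ : ∀ b, b ≠ 2 → b ≠ 3 → b ≠ 4 → σ₅ b = σ b := fun b h2 h3 h4 => by
    rw [f₅ b h4, f₄ b h3, e₃ b h2 h3]
  have i₅ : RatioInv G A 0 σ₅ := by
    refine ⟨hasGraph_congr hG (e₅ 0 (by decide) (by decide) (by decide)), A₂.congr ?_,
      c₄.congr (f₅ 3 (by decide)), fun v => ?_, by simp, by simp,
      h1.congr (e₅ 1 (by decide) (by decide) (by decide))⟩
    · rw [f₅ 2 (by decide), f₄ 2 (by decide), f₃ 2 (by decide)]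
    · rw [hσ₅, run_set_self _ _ v.pos v.2]
      rfl
  clear_value σ₅
  have i₆ : RatioInv G A n ((Stmt.loop 11 ratioStmt).run n ρ σ₅) :=
    iter_induct (fun k τ => RatioInv G A k τ) i₅ fun k hk τ hτ => hτ.step hk (by simp)
  set σ₆ := (Stmt.loop 11 ratioStmt).run n ρ σ₅
  clear_value σ₆
  -- The still empty array `1` represents `solve` with no rounds, the start of the reverse phase.
  have i₇ : ReverseInv G A n ((Stmt.loop 11 reverseStmt).run n ρ σ₆) :=
    iter_induct (fun k τ => ReverseInv G A k τ)
      ⟨i₆.graph, i₆.alive, i₆.sets, i₆.picks, i₆.out⟩ fun k hk τ hτ => hτ.step hk (by simp)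
  set σ₇ := (Stmt.loop 11 reverseStmt).run n ρ σ₆
  clear_value σ₇
  refine ⟨A, g₂, fun S hS => ?_, hasSet_run_set Fin.pos fun v => ?_⟩
  · have := s₂.card S hS
    rwa [a₁, ← compl_eq_univ_sdiff] at this
  · have h2 := i₇.alive v
    have h3 := i₇.out v
    rw [Nat.sub_self] at h3
    simp only [sat_cond, sat_const, sat_not, sat_mem, mem_union, mem_compl]
    simp only [cellEnv, Function.update_self]
    rw [h2, h3]
    change _ ↔ v ∈ solve G.adjacency n (ratioState G A 0) ∨ v ∉ A
    tauto

theorem isDeletionSet_iff (S : Finset (Fin n)) :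
    IsDeletionSet G S ↔ Good G.adjacency Sᶜ ∧ Dismantlable G.adjacency Sᶜ := by
  rw [IsDeletionSet, ← coe_compl, isBlockGraph_induce_iff]
  exact ⟨fun h => ⟨h.good, h.dismantlable⟩, fun h => cliqueBlocks_of_dismantlable h.1 h.2⟩

end Program

/-! ### The approximation guarantee. -/

theorem isApproxAlgorithm_algorithm : IsApproxAlgorithm 4 (algorithm.comp 0) := by
  open Finset in
  refine ⟨algorithm.time, fun n G => ?_⟩
  obtain ⟨t, s, hexec, ht, hs⟩ := algorithm.exec_input G
  obtain ⟨A, hg, hcard, hout⟩ := algorithm_run (G := G) (n := n) (fun _ => 0)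
    (σ := fun a => (input G).arr (loc a)) (fun u v => by simp [input, loc])
    (fun v => by simp [input, loc])
  have hsol := isSolution_solve (G := G.adjacency) n (core G.adjacency A) (fun _ => 1)
    (hg.mono (core_subset A)) (fun v => not_simplicial_of_mem_core)
    ((card_le_univ _).trans (Fintype.card_fin n).le)
  set F := solve G.adjacency n (core G.adjacency A, fun _ => 1) with hF
  have houtput : output n s = F ∪ Aᶜ := by
    ext v
    rw [output, mem_filter, hs, ← hout v]
    simp
  refine ⟨t, s, hexec, ht, ?_, ?_⟩
  · have hcompl : (output n s)ᶜ = A \ F := by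
      rw [houtput]
      ext v
      simp only [mem_compl, mem_union, mem_sdiff]
      tauto
    rw [isDeletionSet_iff, hcompl]
    exact ⟨hg.mono sdiff_subset, dismantlable_core_sdiff hsol.dismantlable⟩
  -- An optimal `S` splits into `S ∩ A`, which pays for `F` (all initial weights are 1), and `S ∩
  -- Aᶜ`, which pays for `Aᶜ`, each with factor four.
  · obtain ⟨S, hS, hopt⟩ := exists_card_eq_opt G
    obtain ⟨hSg, hSd⟩ := (isDeletionSet_iff S).1 hS
    have h1 := hcard S hSg
    have h2 := hsol.le (S ∩ core G.adjacency A) inter_subset_right (hSd.mono fun v hv => by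
      simp only [mem_sdiff, mem_inter, mem_compl] at hv ⊢
      tauto)
    simp only [sum_const, smul_eq_mul, mul_one] at h2
    have h3 : #(S ∩ core G.adjacency A) ≤ #(S ∩ A) :=
      card_le_card (inter_subset_inter Subset.rfl (core_subset A))
    have h4 : #(S ∩ A) + #(S ∩ Aᶜ) = #S := by
      rw [← card_union_of_disjoint, ← inter_union_distrib_left, union_compl, inter_univ]
      exact disjoint_compl_right.mono inter_subset_right inter_subset_right
    rw [houtput, ← hopt]
    have h5 := card_union_le F Aᶜ
    omega

end BGVD

theorem mainTheorem6 : ∃ p : BGVD.Prog, BGVD.IsApproxAlgorithm 4 p :=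
  ⟨_, BGVD.isApproxAlgorithm_algorithm⟩
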